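/- **Proposition 3.3.** Let $\mathbf R$ be a real closed field and $\mathbf C=\mathbf R[i]$. *Cauchy index.* For $P\in\mathbf R[T]\setminus\{0\}$ and $x\in\mathbf R$ write $P=(T-x)^{\mathrm{mult}_x(P)}P_x$ with $P_x(x)\ne0$. For $P,Q\ne 0$ put $\mathrm{val}_x(P/Q)=\mathrm{mult}_x(P)-\mathrm{mult}_x(Q)$. If $P,Q\neq 0$ and $v=\mathrm{val}_x(P/Q)<0$, let $$\mathrm{Ind}^+_x(P,Q)=\tfrac12\,\mathrm{sign}(P_x(x)Q_x(x)),\qquad \mathrm{Ind}^-_x(P,Q)=\tfrac12(-1)^{v}\,\mathrm{sign}(P_x(x)Q_x(x));$$ otherwise both are $0$. For $a<b$ let $$\mathrm{Ind}_a^b(P,Q)=\mathrm{Ind}_a^+(P,Q)+\sum_{x\in(a,b)}\bigl(\mathrm{Ind}_x^+(P,Q)-\mathrm{Ind}_x^-(P,Q)\bigr)-\mathrm{Ind}_b^-(P,Q),$$ a sum with finitely many nonzero terms; let $\mathrm{Ind}_b^a=-\mathrm{Ind}_a^b$ and $\mathrm{Ind}_a^a=0$. *Winding numbers.* Let $\Gamma=[x_0,x_1]\times[y_0,y_1]\subset\mathbf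 R^2$ with $x_0<x_1$ and $y_0<y_1$. For $F=F_{\rm re}+iF_{\rm im}\in\mathbf C[X,Y]$ with $F_{\rm re},F_{\rm im}\in\mathbf R[X,Y]$, let $\overline F=F_{\rm re}-iF_{\rm im}$, $$\begin{aligned}\mathrm w(F\,|\,\partial\Gamma)=\tfrac12\Bigl(&\mathrm{Ind}_{x_0}^{x_1}\bigl(F_{\rm re}(T,y_0),F_{\rm im}(T,y_0)\bigr)+\mathrm{Ind}_{y_0}^{y_1}\bigl(F_{\rm re}(x_1,T),F_{\rm im}(x_1,T)\bigr)\\&+\mathrm{Ind}_{x_1}^{x_0}\bigl(F_{\rm re}(T,y_1),F_{\rm im}(T,y_1)\bigr)+\mathrm{Ind}_{y_1}^{y_0}\bigl(F_{\rm re}(x_0,T),F_{\rm im}(x_0,T)\bigr)\Bigr),\end{aligned}$$ and $\mathrm W(F\,|\,\partial\Gamma)=\frac12\bigl(\mathrm w(F\,|\,\partial\Gamma)+\mathrm w(iF\,|\,\partial\Gamma)\bigr)$. Regard $\mathbf C[Z]\subset\mathbf C[X,Y]$ through $Z=X+iY$, and for a rational function $F/G\in\mathbf C(Z)$ with $F,G\in\mathbf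 C[Z]$, $G\ne0$, let $\mathrm W(F/G\,|\,\partial\Gamma)=\mathrm W(F\overline G\,|\,\partial\Gamma)$, which does not depend on the choice of $F$ and $G$. *Statement.* For all $F/G,\,H/I\in\mathbf C(Z)\setminus\{0\}$ and every such rectangle $\Gamma$, $$\mathrm W\Bigl(\frac FG\cdot\frac HI\,\Big|\,\partial\Gamma\Bigr)=\mathrm W\Bigl(\frac FG\,\Big|\,\partial\Gamma\Bigr)+\mathrm W\Bigl(\frac HI\,\Big|\,\partial\Gamma\Bigr).$$ -/

import Mathlib

namespace WindingNumber

noncomputable section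

open Polynomial

/-! ### Pairs of univariate polynomials over an ordered field: the Cauchy index -/

/-- The sign of an element, as a rational number in `{-1, 0, 1}`. -/
def sgn {R : Type*} [Field R] [LinearOrder R] (t : R) : ℚ := ((SignType.sign t : SignType) : ℚ)

/-- `P_x`, where `P = (X - x) ^ mult_x(P) * P_x` and `P_x(x) ≠ 0` (for `P ≠ 0`). -/
def cofactor {R : Type*} [Field R] (x : R) (P : R[X]) : R[X] :=
  P /ₘ (X - C x) ^ P.rootMultiplicity x

/-- `val_x(P/Q) = mult_x(P) - mult_x(Q)`; it is only used when `P ≠ 0` and `Q ≠ 0`. -/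
def val {R : Type*} [Field R] (x : R) (P Q : R[X]) : ℤ :=
  (P.rootMultiplicity x : ℤ) - (Q.rootMultiplicity x : ℤ)

open Classical in
/-- The right Cauchy index `Ind_x^+(P, Q)`. -/
def indRight {R : Type*} [Field R] [LinearOrder R] (x : R) (P Q : R[X]) : ℚ :=
  if P ≠ 0 ∧ Q ≠ 0 ∧ val x P Q < 0 then
    1 / 2 * sgn ((cofactor x P).eval x * (cofactor x Q).eval x)
  else 0

open Classical in
/-- The left Cauchy index `Ind_x^-(P, Q)`. -/
def indLeft {R : Type*} [Field R] [LinearOrder R] (x : R) (P Q : R[X]) : ℚ :=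
  if P ≠ 0 ∧ Q ≠ 0 ∧ val x P Q < 0 then
    1 / 2 * (-1 : ℚ) ^ val x P Q * sgn ((cofactor x P).eval x * (cofactor x Q).eval x)
  else 0

/-- The Cauchy index at a point, `Ind_x(P, Q) = Ind_x^+(P, Q) - Ind_x^-(P, Q)`. -/
def indAt {R : Type*} [Field R] [LinearOrder R] (x : R) (P Q : R[X]) : ℚ :=
  indRight x P Q - indLeft x P Q

/-- `Ind_a^b(P, Q)` for `a < b`. The sum over the open interval has only finitely many nonzero
terms, see `finite_support_indAt`. -/
def indLt {R : Type*} [Field R] [LinearOrder R] (a b : R) (P Q : R[X]) : ℚ :=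
  indRight a P Q + (∑ᶠ x ∈ Set.Ioo a b, indAt x P Q) - indLeft b P Q

/-- The Cauchy index `Ind_a^b(P, Q)` for arbitrary `a` and `b`. -/
def cauchyInd {R : Type*} [Field R] [LinearOrder R] (a b : R) (P Q : R[X]) : ℚ :=
  if a < b then indLt a b P Q
  else if b < a then -indLt b a P Q
  else 0

theorem finite_support_indAt {R : Type*} [Field R] [LinearOrder R] (P Q : R[X]) :
    (Function.support fun x => indAt x P Q).Finite := by
  by_cases hQ : Q = 0
  · have h : (fun x => indAt x P Q) = 0 := by
      funext x; simp [indAt, indRight, indLeft, hQ]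
    rw [h]; simp
  · refine (Polynomial.finite_setOfPred_isRoot hQ).subset fun x hx => ?_
    by_contra hr
    apply hx
    have hm : Q.rootMultiplicity x = 0 := rootMultiplicity_eq_zero hr
    have hv : ¬ val x P Q < 0 := by simp [val, hm]
    simp [indAt, indRight, indLeft, hv]

/-! ### The field `R[i]` and bivariate polynomials over it -/

/-- `R[i]`: elements `⟨re, im⟩` with `i ^ 2 = -1`. -/
abbrev Cplx (R : Type*) [Field R] : Type _ := QuadraticAlgebra R (-1) 0

instance factNoSqrt {R : Type*} [Field R] [LinearOrder R] [IsStrictOrderedRing R] :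
    Fact (∀ r : R, r ^ 2 ≠ (-1) + 0 * r) :=
  ⟨fun r h => by nlinarith [sq_nonneg r]⟩

/-- The imaginary unit `i`. -/
def imUnit (R : Type*) [Field R] : Cplx R := ⟨0, 1⟩

/-- `F_re ∈ R[X, Y]`, for `F ∈ R[i][X, Y]`; `X` and `Y` are the variables `0` and `1`. -/
def rePart {R : Type*} [Field R] (F : MvPolynomial (Fin 2) (Cplx R)) : MvPolynomial (Fin 2) R :=
  ∑ m ∈ F.support, MvPolynomial.monomial m (F.coeff m).re

/-- `F_im ∈ R[X, Y]`, for `F ∈ R[i][X, Y]`. -/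
def imPart {R : Type*} [Field R] (F : MvPolynomial (Fin 2) (Cplx R)) : MvPolynomial (Fin 2) R :=
  ∑ m ∈ F.support, MvPolynomial.monomial m (F.coeff m).im

/-- The inclusion `R[X, Y] ⊂ R[i][X, Y]`. -/
def ofRealPoly {R : Type*} [Field R] (A : MvPolynomial (Fin 2) R) :
    MvPolynomial (Fin 2) (Cplx R) :=
  MvPolynomial.map (algebraMap R (Cplx R)) A

/-- The conjugate polynomial `F_re - i F_im` of `F`. -/
def conjPoly {R : Type*} [Field R] (F : MvPolynomial (Fin 2) (Cplx R)) :
    MvPolynomial (Fin 2) (Cplx R) :=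
  ofRealPoly (rePart F) - MvPolynomial.C (imUnit R) * ofRealPoly (imPart F)

/-- The inclusion `R[i][Z] ⊂ R[i][X, Y]` through `Z = X + i Y`. -/
def toXY {R : Type*} [Field R] (F : (Cplx R)[X]) : MvPolynomial (Fin 2) (Cplx R) :=
  Polynomial.aeval (MvPolynomial.X 0 + MvPolynomial.C (imUnit R) * MvPolynomial.X 1) F

/-- `A(T, y) ∈ R[T]`, for `A ∈ R[X, Y]`. -/
def onHorizontal {R : Type*} [Field R] (y : R) (A : MvPolynomial (Fin 2) R) : R[X] :=
  MvPolynomial.aeval ![(Polynomial.X : R[X]), Polynomial.C y] A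

/-- `A(x, T) ∈ R[T]`, for `A ∈ R[X, Y]`. -/
def onVertical {R : Type*} [Field R] (x : R) (A : MvPolynomial (Fin 2) R) : R[X] :=
  MvPolynomial.aeval ![Polynomial.C x, (Polynomial.X : R[X])] A

/-! ### The winding numbers on the boundary of `[x₀, x₁] × [y₀, y₁]` -/

/-- The winding number `w(F | ∂Γ)` of `F ∈ R[i][X, Y]`, with `Γ = [x₀, x₁] × [y₀, y₁]`. -/
def windSmall {R : Type*} [Field R] [LinearOrder R] (F : MvPolynomial (Fin 2) (Cplx R))
    (x₀ x₁ y₀ y₁ : R) : ℚ :=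
  1 / 2 *
    (cauchyInd x₀ x₁ (onHorizontal y₀ (rePart F)) (onHorizontal y₀ (imPart F))
      + cauchyInd y₀ y₁ (onVertical x₁ (rePart F)) (onVertical x₁ (imPart F))
      + cauchyInd x₁ x₀ (onHorizontal y₁ (rePart F)) (onHorizontal y₁ (imPart F))
      + cauchyInd y₁ y₀ (onVertical x₀ (rePart F)) (onVertical x₀ (imPart F)))

/-- The winding number `W(F | ∂Γ) = (w(F | ∂Γ) + w(iF | ∂Γ)) / 2` of `F ∈ R[i][X, Y]`. -/
def windBig {R : Type*} [Field R] [LinearOrder R] (F : MvPolynomial (Fin 2) (Cplx R))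
    (x₀ x₁ y₀ y₁ : R) : ℚ :=
  1 / 2 * (windSmall F x₀ x₁ y₀ y₁
    + windSmall (MvPolynomial.C (imUnit R) * F) x₀ x₁ y₀ y₁)

/-- The winding number `W(f | ∂Γ)` of a rational function `f = F/G ∈ R[i](Z)`, that is
`W(F * conj G | ∂Γ)`. The definition uses the coprime representation of `f`; by `windRat_div` any
other numerator and denominator in `R[i][Z]` give the same value. -/
def windRat {R : Type*} [Field R] [LinearOrder R] [IsStrictOrderedRing R] (f : RatFunc (Cplx R))
    (x₀ x₁ y₀ y₁ : R) : ℚ :=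
  windBig (toXY f.num * conjPoly (toXY f.denom)) x₀ x₁ y₀ y₁

/-! ### Facts showing that the definitions are the intended ones -/

theorem coeff_rePart {R : Type*} [Field R] (F : MvPolynomial (Fin 2) (Cplx R)) (m : Fin 2 →₀ ℕ) :
    (rePart F).coeff m = (F.coeff m).re := by
  classical
  simp only [rePart, MvPolynomial.coeff_sum, MvPolynomial.coeff_monomial]
  rw [Finset.sum_ite_eq' F.support m]
  split_ifs with h
  · rfl
  · rw [MvPolynomial.notMem_support_iff.1 h]; rfl

theorem coeff_imPart {R : Type*} [Field R] (F : MvPolynomial (Fin 2) (Cplx R)) (m : Fin 2 →₀ ℕ) :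
    (imPart F).coeff m = (F.coeff m).im := by
  classical
  simp only [imPart, MvPolynomial.coeff_sum, MvPolynomial.coeff_monomial]
  rw [Finset.sum_ite_eq' F.support m]
  split_ifs with h
  · rfl
  · rw [MvPolynomial.notMem_support_iff.1 h]; rfl

theorem re_add_im {R : Type*} [Field R] (F : MvPolynomial (Fin 2) (Cplx R)) :
    ofRealPoly (rePart F) + MvPolynomial.C (imUnit R) * ofRealPoly (imPart F) = F := by
  ext m <;>
  simp [ofRealPoly, MvPolynomial.coeff_map, MvPolynomial.coeff_C_mul, coeff_rePart, coeff_imPart,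
    imUnit]

theorem rePart_eq {R : Type*} [Field R] {F : MvPolynomial (Fin 2) (Cplx R)}
    {A B : MvPolynomial (Fin 2) R}
    (h : F = ofRealPoly A + MvPolynomial.C (imUnit R) * ofRealPoly B) : rePart F = A := by
  ext m
  rw [coeff_rePart, h]
  simp [ofRealPoly, MvPolynomial.coeff_map, MvPolynomial.coeff_C_mul, imUnit]

theorem imPart_eq {R : Type*} [Field R] {F : MvPolynomial (Fin 2) (Cplx R)}
    {A B : MvPolynomial (Fin 2) R}
    (h : F = ofRealPoly A + MvPolynomial.C (imUnit R) * ofRealPoly B) : imPart F = B := by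
  ext m
  rw [coeff_imPart, h]
  simp [ofRealPoly, MvPolynomial.coeff_map, MvPolynomial.coeff_C_mul, imUnit]

theorem cofactor_mul {R : Type*} [Field R] (x : R) {K P : R[X]} (hK : K ≠ 0) (hP : P ≠ 0) :
    cofactor x (K * P) = cofactor x K * cofactor x P := by
  have hX : (X - C x : R[X]) ^ (K * P).rootMultiplicity x ≠ 0 :=
    pow_ne_zero _ (X_sub_C_ne_zero x)
  apply mul_left_cancel₀ hX
  have h1 := pow_mul_divByMonic_rootMultiplicity_eq (K * P) x
  have h2 := pow_mul_divByMonic_rootMultiplicity_eq K x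
  have h3 := pow_mul_divByMonic_rootMultiplicity_eq P x
  unfold cofactor
  rw [h1, rootMultiplicity_mul (mul_ne_zero hK hP), pow_add]
  conv_lhs => rw [← h2, ← h3]
  ring

theorem eval_cofactor_ne_zero {R : Type*} [Field R] (x : R) {K : R[X]} (hK : K ≠ 0) :
    (cofactor x K).eval x ≠ 0 :=
  eval_divByMonic_pow_rootMultiplicity_ne_zero x hK

theorem val_mul {R : Type*} [Field R] (x : R) {K P Q : R[X]} (hK : K ≠ 0) (hP : P ≠ 0)
    (hQ : Q ≠ 0) : val x (K * P) (K * Q) = val x P Q := by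
  simp only [val]
  rw [rootMultiplicity_mul (mul_ne_zero hK hP), rootMultiplicity_mul (mul_ne_zero hK hQ)]
  push_cast; ring

theorem sgn_mul {R : Type*} [Field R] [LinearOrder R] [IsStrictOrderedRing R] (x : R)
    {K P Q : R[X]} (hK : K ≠ 0) (hP : P ≠ 0) (hQ : Q ≠ 0) :
    sgn ((cofactor x (K * P)).eval x * (cofactor x (K * Q)).eval x)
      = sgn ((cofactor x P).eval x * (cofactor x Q).eval x) := by
  rw [cofactor_mul x hK hP, cofactor_mul x hK hQ, eval_mul, eval_mul]
  have h := mul_self_pos.2 (eval_cofactor_ne_zero x hK)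
  set k := (cofactor x K).eval x
  set p := (cofactor x P).eval x
  set q := (cofactor x Q).eval x
  have e : k * p * (k * q) = (k * k) * (p * q) := by ring
  simp only [sgn]
  rw [e, sign_mul, sign_pos h, one_mul]

theorem indRight_mul {R : Type*} [Field R] [LinearOrder R] [IsStrictOrderedRing R] (x : R)
    {K : R[X]} (hK : K ≠ 0) (P Q : R[X]) : indRight x (K * P) (K * Q) = indRight x P Q := by
  by_cases hP : P = 0
  · simp [indRight, hP]
  by_cases hQ : Q = 0
  · simp [indRight, hQ]
  simp only [indRight, ne_eq, mul_eq_zero, hK, hP, hQ, or_self, not_false_eq_true, true_and,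
    val_mul x hK hP hQ, sgn_mul x hK hP hQ]

theorem indLeft_mul {R : Type*} [Field R] [LinearOrder R] [IsStrictOrderedRing R] (x : R)
    {K : R[X]} (hK : K ≠ 0) (P Q : R[X]) : indLeft x (K * P) (K * Q) = indLeft x P Q := by
  by_cases hP : P = 0
  · simp [indLeft, hP]
  by_cases hQ : Q = 0
  · simp [indLeft, hQ]
  simp only [indLeft, ne_eq, mul_eq_zero, hK, hP, hQ, or_self, not_false_eq_true, true_and,
    val_mul x hK hP hQ, sgn_mul x hK hP hQ]

theorem cauchyInd_mul {R : Type*} [Field R] [LinearOrder R] [IsStrictOrderedRing R] (a b : R)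
    {K : R[X]} (hK : K ≠ 0) (P Q : R[X]) :
    cauchyInd a b (K * P) (K * Q) = cauchyInd a b P Q := by
  simp only [cauchyInd, indLt, indAt, indRight_mul _ hK, indLeft_mul _ hK]

theorem rePart_mul {R : Type*} [Field R] (k : MvPolynomial (Fin 2) R)
    (F : MvPolynomial (Fin 2) (Cplx R)) : rePart (ofRealPoly k * F) = k * rePart F := by
  refine rePart_eq (B := k * imPart F) ?_
  conv_lhs => rw [← re_add_im F]
  simp only [ofRealPoly, map_mul]; ring

theorem imPart_mul {R : Type*} [Field R] (k : MvPolynomial (Fin 2) R)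
    (F : MvPolynomial (Fin 2) (Cplx R)) : imPart (ofRealPoly k * F) = k * imPart F := by
  refine imPart_eq (A := k * rePart F) ?_
  conv_lhs => rw [← re_add_im F]
  simp only [ofRealPoly, map_mul]; ring

theorem windSmall_mul {R : Type*} [Field R] [LinearOrder R] [IsStrictOrderedRing R]
    {k : MvPolynomial (Fin 2) R} (hh : ∀ y, onHorizontal y k ≠ 0) (hv : ∀ x, onVertical x k ≠ 0)
    (F : MvPolynomial (Fin 2) (Cplx R)) (x₀ x₁ y₀ y₁ : R) :
    windSmall (ofRealPoly k * F) x₀ x₁ y₀ y₁ = windSmall F x₀ x₁ y₀ y₁ := by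
  have eh : ∀ y A, onHorizontal y (k * A) = onHorizontal y k * onHorizontal y A :=
    fun y A => map_mul _ _ _
  have ev : ∀ x A, onVertical x (k * A) = onVertical x k * onVertical x A :=
    fun x A => map_mul _ _ _
  simp only [windSmall, rePart_mul, imPart_mul, eh, ev, cauchyInd_mul _ _ (hh _),
    cauchyInd_mul _ _ (hv _)]

theorem windBig_mul {R : Type*} [Field R] [LinearOrder R] [IsStrictOrderedRing R]
    {k : MvPolynomial (Fin 2) R} (hh : ∀ y, onHorizontal y k ≠ 0) (hv : ∀ x, onVertical x k ≠ 0)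
    (F : MvPolynomial (Fin 2) (Cplx R)) (x₀ x₁ y₀ y₁ : R) :
    windBig (ofRealPoly k * F) x₀ x₁ y₀ y₁ = windBig F x₀ x₁ y₀ y₁ := by
  have e : MvPolynomial.C (imUnit R) * (ofRealPoly k * F)
      = ofRealPoly k * (MvPolynomial.C (imUnit R) * F) := by ring
  simp only [windBig, e, windSmall_mul hh hv]

/-- `F * conj F`, as an element of `R[X, Y]`. -/
def normPoly {R : Type*} [Field R] (F : MvPolynomial (Fin 2) (Cplx R)) : MvPolynomial (Fin 2) R :=
  rePart F ^ 2 + imPart F ^ 2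

theorem imUnit_mul_self (R : Type*) [Field R] : imUnit R * imUnit R = -1 := by
  ext <;> simp [imUnit, QuadraticAlgebra.re_one, QuadraticAlgebra.im_one]

theorem mul_conjPoly {R : Type*} [Field R] (F : MvPolynomial (Fin 2) (Cplx R)) :
    F * conjPoly F = ofRealPoly (normPoly F) := by
  have hI : (MvPolynomial.C (imUnit R) : MvPolynomial (Fin 2) (Cplx R))
      * MvPolynomial.C (imUnit R) = -1 := by
    rw [← map_mul, imUnit_mul_self, map_neg, map_one]
  have e : ofRealPoly (normPoly F) = ofRealPoly (rePart F) ^ 2 + ofRealPoly (imPart F) ^ 2 := by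
    simp [ofRealPoly, normPoly]
  rw [e]
  conv_lhs => enter [1]; rw [← re_add_im F]
  rw [conjPoly]
  linear_combination (-ofRealPoly (imPart F) ^ 2) * hI

theorem eval_ofRealPoly {R : Type*} [Field R] (p : Fin 2 → R) (A : MvPolynomial (Fin 2) R) :
    MvPolynomial.eval (fun j => algebraMap R (Cplx R) (p j)) (ofRealPoly A)
      = algebraMap R (Cplx R) (MvPolynomial.eval p A) := by
  rw [ofRealPoly, MvPolynomial.eval_map, MvPolynomial.eval₂_comp]; rfl

theorem eval_toXY {R : Type*} [Field R] (p : Fin 2 → R) (F : (Cplx R)[X]) :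
    MvPolynomial.eval (fun j => algebraMap R (Cplx R) (p j)) (toXY F)
      = F.eval (⟨p 0, p 1⟩ : Cplx R) := by
  have hp : (⟨p 0, p 1⟩ : Cplx R)
      = algebraMap R (Cplx R) (p 0) + imUnit R * algebraMap R (Cplx R) (p 1) := by
    ext <;> simp [imUnit]
  rw [toXY, Polynomial.aeval_def, Polynomial.hom_eval₂, hp]
  rw [Polynomial.eval, ]
  congr 1
  · ext z <;> simp [MvPolynomial.algebraMap_eq]
  · simp

theorem eval_normPoly_ne_zero {R : Type*} [Field R] [LinearOrder R] [IsStrictOrderedRing R]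
    (p : Fin 2 → R) (F : (Cplx R)[X]) (h : F.eval (⟨p 0, p 1⟩ : Cplx R) ≠ 0) :
    MvPolynomial.eval p (normPoly (toXY F)) ≠ 0 := by
  intro h0
  apply h
  rw [normPoly, map_add, map_pow, map_pow] at h0
  have h1 : MvPolynomial.eval p (rePart (toXY F)) = 0 := by
    nlinarith [sq_nonneg (MvPolynomial.eval p (rePart (toXY F))),
      sq_nonneg (MvPolynomial.eval p (imPart (toXY F)))]
  have h2 : MvPolynomial.eval p (imPart (toXY F)) = 0 := by
    nlinarith [sq_nonneg (MvPolynomial.eval p (rePart (toXY F))),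
      sq_nonneg (MvPolynomial.eval p (imPart (toXY F)))]
  rw [← eval_toXY, ← re_add_im (toXY F), map_add, map_mul, eval_ofRealPoly, eval_ofRealPoly,
    h1, h2]
  simp

theorem onHorizontal_normPoly_ne_zero {R : Type*} [Field R] [LinearOrder R]
    [IsStrictOrderedRing R] {F : (Cplx R)[X]} (hF : F ≠ 0) (y : R) :
    onHorizontal y (normPoly (toXY F)) ≠ 0 := by
  obtain ⟨t, ht⟩ : ∃ t : R, F.eval (⟨t, y⟩ : Cplx R) ≠ 0 := by
    by_contra! hc
    have hinj : Function.Injective fun t : R => (⟨t, y⟩ : Cplx R) :=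
      fun s t h => congrArg QuadraticAlgebra.re h
    exact Set.infinite_of_injective_forall_mem hinj (s := {z | F.IsRoot z}) hc
      (Polynomial.finite_setOfPred_isRoot hF)
  intro h0
  apply eval_normPoly_ne_zero ![t, y] F (by simpa using ht)
  have h1 := congrArg (Polynomial.aeval t) h0
  rw [onHorizontal, ← AlgHom.comp_apply, MvPolynomial.comp_aeval, map_zero] at h1
  rw [← h1, ← MvPolynomial.coe_aeval_eq_eval]
  simp only [RingHom.coe_coe]
  congr 2
  funext j; fin_cases j <;> simp

theorem onVertical_normPoly_ne_zero {R : Type*} [Field R] [LinearOrder R]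
    [IsStrictOrderedRing R] {F : (Cplx R)[X]} (hF : F ≠ 0) (x : R) :
    onVertical x (normPoly (toXY F)) ≠ 0 := by
  obtain ⟨t, ht⟩ : ∃ t : R, F.eval (⟨x, t⟩ : Cplx R) ≠ 0 := by
    by_contra! hc
    have hinj : Function.Injective fun t : R => (⟨x, t⟩ : Cplx R) :=
      fun s t h => congrArg QuadraticAlgebra.im h
    exact Set.infinite_of_injective_forall_mem hinj (s := {z | F.IsRoot z}) hc
      (Polynomial.finite_setOfPred_isRoot hF)
  intro h0
  apply eval_normPoly_ne_zero ![x, t] F (by simpa using ht)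
  have h1 := congrArg (Polynomial.aeval t) h0
  rw [onVertical, ← AlgHom.comp_apply, MvPolynomial.comp_aeval, map_zero] at h1
  rw [← h1, ← MvPolynomial.coe_aeval_eq_eval]
  simp only [RingHom.coe_coe]
  congr 2
  funext j; fin_cases j <;> simp

/-- `W(F/G | ∂Γ) = W(F * conj G | ∂Γ)` for every choice of the numerator and denominator. -/
theorem windRat_div {R : Type*} [Field R] [LinearOrder R] [IsStrictOrderedRing R]
    (F G : (Cplx R)[X]) (hG : G ≠ 0) (x₀ x₁ y₀ y₁ : R) :
    windRat (algebraMap (Cplx R)[X] (RatFunc (Cplx R)) F / algebraMap _ _ G) x₀ x₁ y₀ y₁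
      = windBig (toXY F * conjPoly (toXY G)) x₀ x₁ y₀ y₁ := by
  set f : RatFunc (Cplx R) := algebraMap (Cplx R)[X] (RatFunc (Cplx R)) F / algebraMap _ _ G
    with hf
  have hD : f.denom ≠ 0 := RatFunc.denom_ne_zero f
  have hc : f.num * G = F * f.denom := RatFunc.num_mul_eq_mul_denom_iff hG |>.2 hf
  have hc' : toXY f.num * toXY G = toXY F * toXY f.denom := by
    have := congrArg toXY hc
    simpa only [toXY, map_mul] using this
  have e : ofRealPoly (normPoly (toXY G)) * (toXY f.num * conjPoly (toXY f.denom))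
      = ofRealPoly (normPoly (toXY f.denom)) * (toXY F * conjPoly (toXY G)) := by
    rw [← mul_conjPoly, ← mul_conjPoly]
    linear_combination (conjPoly (toXY G) * conjPoly (toXY f.denom)) * hc'
  rw [windRat, ← windBig_mul (onHorizontal_normPoly_ne_zero hG) (onVertical_normPoly_ne_zero hG),
    e, windBig_mul (onHorizontal_normPoly_ne_zero hD) (onVertical_normPoly_ne_zero hD)]

end

end WindingNumber

/-! Give a nonzero complex number a coarse angle, measured in quarter turns: a multiple of 1 on the
axes, and the angle of the bisector in each open quadrant, so that leaving an axis for an adjacent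
quadrant changes it by ±1/2. The index of `(F_re, F_im)` records the jumps at the real axis and that
of `iF` the jumps at the imaginary axis. Hence `4 W` is the total variation of the coarse angle of
`F` along the four edges (`windBig_eq`). The coarse angle is not additive under multiplication.
Modulo full turns its error at `(u, v)` is `angleDefect u v`, which depends only on the quadrants or
axes containing `u`, `v` and `uv`. A finite case analysis (`jumpFormula`) shows that each jump for a
product is the sum of the jumps of the factors plus the variation of this defect. Along an edge the
variations telescope, leaving the defect at the two endpoints (`edgeIndex_mul`). Going around the
rectangle, these endpoint terms cancel in pairs provided that the two edges at a corner see the same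
defect. At a zero of `F` on a corner, a real polynomial factor is removed on each edge, and the
remaining directions differ by a power of `i` (`cornerCompatible_toXY`); the defect ignores such
powers. Real closedness enters through the telescoping: a polynomial must keep its sign between
consecutive roots (`IsRealClosed.eval_mul_eval_pos`). This follows from the degree bound 2 for
irreducible polynomials, proved by Galois theory. -/

open Polynomial

/-! ### Constancy of sign of polynomials over a real closed field. -/

namespace IsRealClosed

section Extensions

variable {R : Type*} [Field R] [IsRealClosed R]

/-- The minimal polynomial of a primitive element has odd degree, hence a root; being irreducible,
it is linear. -/
theorem finrank_eq_one_of_odd (K : Type*) [Field K] [Algebra R K] [FiniteDimensional R K]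
    (h : Odd (Module.finrank R K)) : Module.finrank R K = 1 := by
  obtain ⟨α, hα⟩ := Field.exists_primitive_element R K
  have hint : IsIntegral R α := Algebra.IsIntegral.isIntegral α
  have hd : (minpoly R α).natDegree = Module.finrank R K := by
    rw [← IntermediateField.adjoin.finrank hint, hα, IntermediateField.finrank_top']
  rw [← hd] at h ⊢
  obtain ⟨x, hx⟩ := exists_isRoot_of_odd_natDegree h
  exact natDegree_eq_of_degree_eq_some
    (degree_eq_one_of_irreducible_of_root (minpoly.irreducible hint) hx)

end Extensions

/-- A field of characteristic other than two has a quadratic extension only if it contains a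
nonsquare. -/
theorem exists_sq_eq_algebraMap_of_finrank_eq_two {F K : Type*} [Field F] [Field K] [Algebra F K]
    [CharZero F] (h : Module.finrank F K = 2) :
    ∃ d : F, ¬ IsSquare d ∧ ∃ α : K, α ^ 2 = algebraMap F K d := by
  have : FiniteDimensional F K := Module.finite_of_finrank_eq_succ h
  obtain ⟨α, hα⟩ := Field.exists_primitive_element F K
  have hint : IsIntegral F α := Algebra.IsIntegral.isIntegral α
  have hd : (minpoly F α).natDegree = 2 := by
    rw [← IntermediateField.adjoin.finrank hint, hα, IntermediateField.finrank_top', h]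
  have hm := minpoly.monic hint
  set p := minpoly F α with hp
  have hc : p.coeff 2 = 1 := by rw [← hd]; exact hm
  have hX : p = X ^ 2 + C (p.coeff 1) * X + C (p.coeff 0) := by
    conv_lhs => rw [p.as_sum_range_C_mul_X_pow, hd]
    simp [Finset.sum_range_succ, hc]
    ring
  have hev : ∀ z, p.eval z = z ^ 2 + p.coeff 1 * z + p.coeff 0 := fun z => by
    conv_lhs => rw [hX]
    simp
  -- The discriminant of the minimal polynomial `p` of `α`, with square root `p'(α)`.
  refine ⟨p.coeff 1 ^ 2 - 4 * p.coeff 0, ?_, 2 * α + algebraMap F K (p.coeff 1), ?_⟩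
  · rintro ⟨s, hs⟩
    have hr : p.IsRoot ((s - p.coeff 1) / 2) := by
      rw [IsRoot, hev]
      field_simp
      linear_combination -hs
    have : p.natDegree = 1 := natDegree_eq_of_degree_eq_some
      (degree_eq_one_of_irreducible_of_root (minpoly.irreducible hint) hr)
    omega
  · have h0 : aeval α p = 0 := minpoly.aeval F α
    rw [hX] at h0
    simp only [map_add, map_mul, map_pow, aeval_X, aeval_C] at h0
    simp only [map_sub, map_pow, map_mul, map_ofNat]
    linear_combination 4 * h0

section Extensions

variable {R : Type*} [Field R] [LinearOrder R] [IsStrictOrderedRing R] [IsRealClosed R]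

/-- The extension is `R(i)`: it contains a square root of some nonsquare `d`, and `-d` is a square
in `R`. Square roots in `R(i)` are then given by the explicit formula through the modulus. -/
theorem isSquare_of_finrank_eq_two {K : Type*} [Field K] [Algebra R K]
    (h : Module.finrank R K = 2) (z : K) : IsSquare z := by
  have : CharZero K := charZero_of_injective_algebraMap (algebraMap R K).injective
  obtain ⟨d, hd, α, hα⟩ := exists_sq_eq_algebraMap_of_finrank_eq_two h
  obtain ⟨e, he⟩ := isSquare_neg_of_not_isSquare hd
  have he0 : algebraMap R K e ≠ 0 := by
    rw [Ne, map_eq_zero]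
    rintro rfl
    exact hd ⟨0, by linear_combination -he⟩
  have he' : -(algebraMap R K d) = algebraMap R K e * algebraMap R K e := by
    rw [← map_neg, he, map_mul]
  set i : K := α / algebraMap R K e with hi
  have hii : i ^ 2 = -1 := by
    rw [hi, div_pow, hα]; field_simp; linear_combination -he'
  have hli : LinearIndependent R ![(1 : K), i] := by
    rw [LinearIndependent.pair_iff]
    intro s t hst
    rw [Algebra.smul_def, Algebra.smul_def, mul_one] at hst
    have h1 : algebraMap R K (s ^ 2 + t ^ 2) = 0 := by
      rw [map_add, map_pow, map_pow]
      linear_combination (algebraMap R K s - algebraMap R K t * i) * hst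
        + algebraMap R K t ^ 2 * hii
    rw [map_eq_zero] at h1
    constructor <;> nlinarith [sq_nonneg s, sq_nonneg t]
  have hspan := hli.span_eq_top_of_card_eq_finrank (by simp [h])
  have hz : z ∈ Submodule.span R (Set.range ![(1 : K), i]) := by rw [hspan]; trivial
  rw [Matrix.range_cons, Matrix.range_cons, Matrix.range_empty, Set.union_empty,
    Set.singleton_union, Submodule.mem_span_pair] at hz
  obtain ⟨x, y, rfl⟩ := hz
  -- `r` is the modulus of `x + iy`; the root sought has real part `√((r + x)/2)` and imaginary part
  -- `±√((r - x)/2)`.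
  obtain ⟨r, hr0, hr⟩ : ∃ r : R, 0 ≤ r ∧ r ^ 2 = x ^ 2 + y ^ 2 := by
    obtain ⟨r, hr⟩ := IsSquare.of_nonneg (show (0 : R) ≤ x ^ 2 + y ^ 2 by positivity)
    exact ⟨|r|, abs_nonneg r, by rw [sq_abs, hr, sq]⟩
  have hx := abs_le.1 (abs_le_of_sq_le_sq (show x ^ 2 ≤ r ^ 2 by nlinarith [sq_nonneg y]) hr0)
  obtain ⟨u, hu⟩ := IsSquare.of_nonneg (show (0 : R) ≤ (r + x) / 2 by linarith)
  obtain ⟨v, hv⟩ := IsSquare.of_nonneg (show (0 : R) ≤ (r - x) / 2 by linarith)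
  have huv : (2 * u * v) ^ 2 = y ^ 2 := by
    linear_combination (-4 * v * v) * hu - 4 * ((r + x) / 2) * hv + hr
  have hx' : x = u ^ 2 - v ^ 2 := by linear_combination hu - hv
  -- The sign of the imaginary part `w = ±v` is dictated by `y = 2uw`.
  have key : ∀ w : R, y = 2 * u * w → w ^ 2 = v ^ 2 → IsSquare (x • (1 : K) + y • i) := by
    intro w hw hw2
    refine ⟨algebraMap R K u + algebraMap R K w * i, ?_⟩
    rw [hx', hw, ← hw2, Algebra.smul_def, Algebra.smul_def]
    simp only [map_sub, map_pow, map_mul, map_ofNat]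
    linear_combination (-algebraMap R K w ^ 2) * hii
  rcases sq_eq_sq_iff_eq_or_eq_neg.1 huv.symm with h1 | h1
  · exact key v h1 rfl
  · exact key (-v) (by linear_combination h1)
      (neg_sq v)

end Extensions

/-- The fixed field of a subgroup of order `2 ^ n`, which has index 2 in the Galois group. -/
theorem exists_intermediateField_finrank_eq_two {F L : Type*} [Field F] [Field L] [Algebra F L]
    [FiniteDimensional F L] [IsGalois F L] {n : ℕ} (h : Module.finrank F L = 2 ^ (n + 1)) :
    ∃ K : IntermediateField F L, Module.finrank F K = 2 ∧ Module.finrank K L = 2 ^ n := by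
  have hc : Nat.card Gal(L/F) = 2 ^ (n + 1) := by rw [IsGalois.card_aut_eq_finrank, h]
  have : Fact (Nat.Prime 2) := ⟨Nat.prime_two⟩
  obtain ⟨H, hH⟩ := Sylow.exists_subgroup_card_pow_prime (G := Gal(L/F)) 2 (n := n)
    (by rw [hc]; exact pow_dvd_pow 2 n.le_succ)
  have h1 : Module.finrank (IntermediateField.fixedField H) L = 2 ^ n := by
    rw [IntermediateField.finrank_fixedField_eq_card, hH]
  refine ⟨IntermediateField.fixedField H, ?_, h1⟩
  have h2 := Module.finrank_mul_finrank F (IntermediateField.fixedField H) L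
  rw [h1, h, pow_succ, mul_comm] at h2
  exact Nat.eq_of_mul_eq_mul_left (by positivity) h2

section Polynomials

variable {R : Type*} [Field R] [LinearOrder R] [IsStrictOrderedRing R] [IsRealClosed R]

theorem finrank_le_two_of_isGalois (L : Type*) [Field L] [Algebra R L] [FiniteDimensional R L]
    [IsGalois R L] : Module.finrank R L ≤ 2 := by
  have : Fact (Nat.Prime 2) := ⟨Nat.prime_two⟩
  have : CharZero L := charZero_of_injective_algebraMap (algebraMap R L).injective
  obtain ⟨n, hn⟩ : ∃ n, Module.finrank R L = 2 ^ n := by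
    -- The fixed field of a Sylow 2-subgroup has odd degree over `R`, hence is `R` itself, so the
    -- Galois group is a 2-group.
    let P : Sylow 2 Gal(L/R) := default
    have h1 : Module.finrank (IntermediateField.fixedField (P : Subgroup Gal(L/R))) L
        = Nat.card P := IntermediateField.finrank_fixedField_eq_card _
    have h2 := Module.finrank_mul_finrank R
      (IntermediateField.fixedField (P : Subgroup Gal(L/R))) L
    have h3 : ¬ 2 ∣ (P : Subgroup Gal(L/R)).index := P.not_dvd_index
    have h4 := (P : Subgroup Gal(L/R)).index_mul_card
    rw [IsGalois.card_aut_eq_finrank, ← h2, h1] at h4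
    have h5 := Nat.eq_of_mul_eq_mul_right Nat.card_pos h4
    rw [h5, ← even_iff_two_dvd, Nat.not_even_iff_odd] at h3
    rw [finrank_eq_one_of_odd _ h3, one_mul, h1] at h2
    rw [← h2]
    exact IsPGroup.iff_card.1 P.isPGroup'
  rcases n with _ | _ | n
  · simp [hn]
  · simp [hn]
  · exfalso
    -- A tower of two quadratic extensions would need a nonsquare in the quadratic extension `K` of
    -- `R`.
    obtain ⟨K, hK, hKL⟩ := exists_intermediateField_finrank_eq_two hn
    obtain ⟨M, hM, -⟩ := exists_intermediateField_finrank_eq_two hKL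
    obtain ⟨d, hd, -⟩ := exists_sq_eq_algebraMap_of_finrank_eq_two hM
    exact hd (isSquare_of_finrank_eq_two hK d)

theorem natDegree_le_two_of_irreducible {p : R[X]} (hp : Irreducible p) : p.natDegree ≤ 2 := by
  have : IsGalois R p.SplittingField := IsGalois.of_separable_splitting_field hp.separable
  obtain ⟨α, hα⟩ := Polynomial.Splits.exists_eval_eq_zero (SplittingField.splits p)
    (by rw [degree_map]; exact (degree_pos_of_irreducible hp).ne')
  have hα' : aeval α p = 0 := by rwa [eval_map_algebraMap] at hα
  have h1 := natDegree_eq_of_degree_eq (degree_eq_degree_of_associated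
    ((minpoly.irreducible (Algebra.IsIntegral.isIntegral α)).associated_of_dvd hp
      (minpoly.dvd R α hα')))
  rw [← h1]
  exact (minpoly.natDegree_le α).trans (finrank_le_two_of_isGalois p.SplittingField)

/-- In degree at most 1 this is explicit. An irreducible quadratic has negative discriminant, since
nonnegative elements are squares, and completing the square fixes its sign everywhere. -/
theorem eval_mul_eval_pos_of_irreducible {p : R[X]} (hp : Irreducible p) {a b : R} (hab : a ≤ b)
    (h : ∀ x ∈ Set.Icc a b, p.eval x ≠ 0) : 0 < p.eval a * p.eval b := by
  have hd := natDegree_le_two_of_irreducible hp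
  have hd0 : 0 < p.natDegree := hp.natDegree_pos
  have he : ∀ x, p.eval x = p.coeff 2 * x ^ 2 + p.coeff 1 * x + p.coeff 0 := by
    intro x
    rw [eval_eq_sum_range' (Nat.lt_succ_of_le hd)]
    simp [Finset.sum_range_succ]
    ring
  set u := p.coeff 2
  set v := p.coeff 1
  set w := p.coeff 0
  by_cases hu : u = 0
  · by_cases hv : v = 0
    · rw [he, he, hu, hv]
      have := h a ⟨le_rfl, hab⟩
      rw [he, hu, hv] at this
      have hw : w ≠ 0 := by simpa using this
      nlinarith [mul_self_pos.2 hw]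
    · by_contra! hc
      have e : ∀ x, p.eval x = v * (x - -w / v) := fun x => by
        rw [he, hu]; field_simp; ring
      have hv2 : 0 < v * v := mul_self_pos.2 hv
      rw [e, e] at hc
      have hc' : (a - -w / v) * (b - -w / v) ≤ 0 := by
        by_contra! h'
        nlinarith [mul_pos hv2 h']
      refine h (-w / v) ⟨?_, ?_⟩ (by rw [e]; ring)
      · by_contra! h'
        nlinarith
      · by_contra! h'
        nlinarith
  · have hroot : ∀ x, p.eval x ≠ 0 := by
      intro x hx
      have h1 : p.natDegree = 1 :=
        natDegree_eq_of_degree_eq_some (degree_eq_one_of_irreducible_of_root hp hx)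
      exact hu (coeff_eq_zero_of_natDegree_lt (by omega))
    have hdisc : v ^ 2 - 4 * u * w < 0 := by
      by_contra! hc
      obtain ⟨s, hs⟩ := IsSquare.of_nonneg hc
      apply hroot ((s - v) / (2 * u))
      rw [he]
      field_simp
      linear_combination -hs
    have hpos : ∀ x, 0 < 4 * u * p.eval x := fun x => by
      rw [he]; nlinarith [sq_nonneg (2 * u * x + v)]
    have := mul_pos (hpos a) (hpos b)
    have hu2 : 0 < u * u := mul_self_pos.2 hu
    by_contra! hc
    nlinarith

/-- A polynomial without roots on an interval takes values of the same sign at its endpoints. -/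
theorem eval_mul_eval_pos {p : R[X]} {a b : R} (hab : a ≤ b)
    (h : ∀ x ∈ Set.Icc a b, p.eval x ≠ 0) : 0 < p.eval a * p.eval b := by
  induction p using WfDvdMonoid.induction_on_irreducible with
  | zero => exact absurd (eval_zero) (h a ⟨le_rfl, hab⟩)
  | unit p hp =>
    obtain ⟨r, hr, rfl⟩ := Polynomial.isUnit_iff.1 hp
    simpa using mul_self_pos.2 hr.ne_zero
  | mul q p hq hp ih =>
    have h1 := eval_mul_eval_pos_of_irreducible hp hab fun x hx h0 => h x hx (by simp [h0])
    have h2 := ih fun x hx h0 => h x hx (by simp [h0])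
    rw [eval_mul, eval_mul]
    nlinarith [mul_pos h1 h2]

end Polynomials

end IsRealClosed

/-! ### Signs, and the coarse angle of a product. -/

namespace WindingNumber

section Sign

variable {R : Type*} [Field R] [LinearOrder R]

theorem sgn_zero : sgn (0 : R) = 0 := by simp [sgn]

theorem sgn_of_pos {t : R} (h : 0 < t) : sgn t = 1 := by simp [sgn, sign_pos h]

theorem sgn_of_neg {t : R} (h : t < 0) : sgn t = -1 := by simp [sgn, sign_neg h]

variable [IsStrictOrderedRing R]

theorem sgn_mul_eq (s t : R) : sgn (s * t) = sgn s * sgn t := by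
  simp [sgn, sign_mul]

theorem sgn_neg (t : R) : sgn (-t) = -sgn t := by
  rcases lt_trichotomy t 0 with h | rfl | h
  · rw [sgn_of_neg h, sgn_of_pos (neg_pos.2 h), neg_neg]
  · simp [sgn_zero]
  · rw [sgn_of_pos h, sgn_of_neg (neg_neg_iff_pos.2 h)]

theorem sgn_mul_self {t : R} (h : t ≠ 0) : sgn t * sgn t = 1 := by
  rw [← sgn_mul_eq, sgn_of_pos (mul_self_pos.2 h)]

theorem sgn_pow (t : R) (n : ℕ) : sgn (t ^ n) = sgn t ^ n := by
  induction n with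
  | zero => simp [sgn_of_pos]
  | succ n ih => rw [pow_succ, pow_succ, sgn_mul_eq, ih]

theorem sgn_eq_of_mul_pos {s t : R} (h : 0 < s * t) : sgn s = sgn t := by
  rcases pos_and_pos_or_neg_and_neg_of_mul_pos h with ⟨h1, h2⟩ | ⟨h1, h2⟩
  · rw [sgn_of_pos h1, sgn_of_pos h2]
  · rw [sgn_of_neg h1, sgn_of_neg h2]

end Sign

theorem re_imUnit_mul {R : Type*} [Field R] (u : Cplx R) : (imUnit R * u).re = -u.im := by
  simp [imUnit]

theorem im_imUnit_mul {R : Type*} [Field R] (u : Cplx R) : (imUnit R * u).im = u.re := by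
  simp [imUnit]

section Quadrants

variable {R : Type*} [Field R] [LinearOrder R]

/-- The parity of the open quadrant containing `u`: `1` for the first and third quadrants, `-1` for
the second and fourth ones, `0` on the axes. -/
noncomputable def quadSign (u : Cplx R) : ℚ := sgn (u.re * u.im)

/-- The amount by which the quadrant-valued angle fails to be additive at `u` and `v`. -/
noncomputable def angleDefect (u v : Cplx R) : ℚ :=
  -(1 / 2) * (quadSign u * quadSign v * quadSign (u * v))

open Classical in
/-- `1` on the real axis, `-1` on the imaginary axis, `0` elsewhere (for nonzero arguments). -/
noncomputable def axisSign (u : Cplx R) : ℚ :=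
  (if u.im = 0 then 1 else 0) - (if u.re = 0 then 1 else 0)

/-- The nonzero coordinates of `u` and the corresponding coordinates of `u'` have the same signs. -/
def SignAdherent (u u' : Cplx R) : Prop :=
  (u.re ≠ 0 → sgn u'.re = sgn u.re) ∧ (u.im ≠ 0 → sgn u'.im = sgn u.im)

theorem angleDefect_comm (u v : Cplx R) : angleDefect u v = angleDefect v u := by
  rw [angleDefect, angleDefect, mul_comm u v]; ring

theorem axisSign_imUnit_mul (u : Cplx R) : axisSign (imUnit R * u) = -axisSign u := by
  simp only [axisSign, re_imUnit_mul, im_imUnit_mul, neg_eq_zero]; ring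

/-- Moving from `u`, `v` to nearby points `u'`, `v'`, the jump of the quadrant-valued angle is
additive up to the variation of the angle defect. -/
def JumpFormula (u v u' v' : Cplx R) : Prop :=
  quadSign (u' * v') * axisSign (u * v) - quadSign u' * axisSign u - quadSign v' * axisSign v
    = 2 * angleDefect u' v' - 2 * angleDefect u v

theorem JumpFormula.symm {u v u' v' : Cplx R} (h : JumpFormula u v u' v') :
    JumpFormula v u v' u' := by
  unfold JumpFormula at h ⊢
  rw [mul_comm v u, mul_comm v' u', angleDefect_comm v, angleDefect_comm v']
  linear_combination h

variable [IsStrictOrderedRing R]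

theorem quadSign_imUnit_mul (u : Cplx R) : quadSign (imUnit R * u) = -quadSign u := by
  rw [quadSign, quadSign, re_imUnit_mul, im_imUnit_mul, ← sgn_neg]
  congr 1; ring

theorem SignAdherent.imUnit_mul {u u' : Cplx R} (h : SignAdherent u u') :
    SignAdherent (imUnit R * u) (imUnit R * u') := by
  simp only [SignAdherent, re_imUnit_mul, im_imUnit_mul, sgn_neg, ne_eq, neg_eq_zero, neg_inj]
  exact ⟨h.2, h.1⟩

theorem angleDefect_imUnit_mul (u v : Cplx R) :
    angleDefect (imUnit R * u) v = angleDefect u v := by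
  rw [angleDefect, angleDefect, mul_assoc (imUnit R), quadSign_imUnit_mul, quadSign_imUnit_mul]
  ring

theorem angleDefect_imUnit_pow_mul (m : ℕ) (u v : Cplx R) :
    angleDefect (imUnit R ^ m * u) v = angleDefect u v := by
  induction m with
  | zero => simp
  | succ m ih => rw [pow_succ', mul_assoc, angleDefect_imUnit_mul, ih]

theorem sgn_of_sub {a b : R} (ha : a ≠ 0) (h : sgn (a - b) = sgn a) :
    0 < a * (a - b) := by
  rcases lt_or_gt_of_ne ha with h1 | h1 <;> rcases lt_trichotomy (a - b) 0 with h2 | h2 | h2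
  · exact mul_pos_of_neg_of_neg h1 h2
  · rw [h2, sgn_zero, sgn_of_neg h1] at h; norm_num at h
  · rw [sgn_of_pos h2, sgn_of_neg h1] at h; norm_num at h
  · rw [sgn_of_neg h2, sgn_of_pos h1] at h; norm_num at h
  · rw [h2, sgn_zero, sgn_of_pos h1] at h; norm_num at h
  · exact mul_pos h1 h2

/-- Let `s` and `t` be the slopes of `u` and `v`. The hypothesis says `st < 1`, so the slope `(s +
t)/(1 - st)` of the product has the sign of `s + t`, and `sgn (s + t) - sgn s - sgn t = -(sgn s *
sgn t * sgn (s + t))`. -/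
theorem quadSign_mul_of_near_real {u v : Cplx R} (hu : u.re ≠ 0) (hv : v.re ≠ 0)
    (h : sgn (u * v).re = sgn (u.re * v.re)) :
    quadSign (u * v) - quadSign u - quadSign v
      = -(quadSign u * quadSign v * quadSign (u * v)) := by
  have hre : (u * v).re = u.re * v.re - u.im * v.im := by simp; ring
  have hp := sgn_of_sub (mul_ne_zero hu hv) (hre ▸ h)
  -- The argument of `sgn` is the sum of the two slopes, multiplied by `(u.re * v.re) ^ 2`.
  have e : quadSign (u * v) = sgn (v.re ^ 2 * (u.re * u.im) + u.re ^ 2 * (v.re * v.im)) := by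
    have : v.re ^ 2 * (u.re * u.im) + u.re ^ 2 * (v.re * v.im)
        = (u.re * v.re) * (u * v).im := by simp; ring
    rw [this, sgn_mul_eq, quadSign, sgn_mul_eq, h]
  have hu2 : 0 < u.re ^ 2 := by positivity
  have hv2 : 0 < v.re ^ 2 := by positivity
  rw [e]
  unfold quadSign
  set α := u.re * u.im
  set β := v.re * v.im
  rcases lt_trichotomy α 0 with h1 | h1 | h1 <;> rcases lt_trichotomy β 0 with h2 | h2 | h2
  · rw [sgn_of_neg h1, sgn_of_neg h2, sgn_of_neg]
    · norm_num
    · nlinarith [mul_pos hv2 (neg_pos.2 h1), mul_pos hu2 (neg_pos.2 h2)]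
  · rw [h2, mul_zero, add_zero, sgn_mul_eq, sgn_of_pos hv2, sgn_of_neg h1, sgn_zero]; norm_num
  · rw [sgn_of_neg h1, sgn_of_pos h2]; ring
  · rw [h1, mul_zero, zero_add, sgn_mul_eq, sgn_of_pos hu2, sgn_of_neg h2, sgn_zero]; norm_num
  · rw [h1, h2, mul_zero, mul_zero, add_zero, sgn_zero]; norm_num
  · rw [h1, mul_zero, zero_add, sgn_mul_eq, sgn_of_pos hu2, sgn_of_pos h2, sgn_zero]; norm_num
  · rw [sgn_of_pos h1, sgn_of_neg h2]; ring
  · rw [h2, mul_zero, add_zero, sgn_mul_eq, sgn_of_pos hv2, sgn_of_pos h1, sgn_zero]; norm_num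
  · rw [sgn_of_pos h1, sgn_of_pos h2, sgn_of_pos]
    · norm_num
    · positivity

theorem ne_zero_of_sgn_eq {s t : R} (ht : t ≠ 0) (h : sgn s = sgn t) : s ≠ 0 := by
  rintro rfl
  rw [sgn_zero] at h
  have := sgn_mul_self ht
  rw [← h] at this
  norm_num at this

theorem SignAdherent.quadSign_eq {u u' : Cplx R} (h : SignAdherent u u') (hr : u.re ≠ 0)
    (hi : u.im ≠ 0) : quadSign u' = quadSign u := by
  rw [quadSign, quadSign, sgn_mul_eq, sgn_mul_eq, h.1 hr, h.2 hi]

/-- Multiplying by `i` reverses `quadSign` and `axisSign` and preserves the defect. This lets a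
factor on the imaginary axis be rotated to the real one. -/
theorem JumpFormula.of_imUnit_mul {u v u' v' : Cplx R}
    (h : JumpFormula (imUnit R * u) v (imUnit R * u') v') : JumpFormula u v u' v' := by
  unfold JumpFormula at h ⊢
  simp only [mul_assoc, quadSign_imUnit_mul, axisSign_imUnit_mul, angleDefect_imUnit_mul] at h
  linear_combination h

theorem jumpFormula_of_im_eq_zero {u v u' v' : Cplx R} (hu : SignAdherent u u')
    (hv : SignAdherent v v') (huv : SignAdherent (u * v) (u' * v')) (hi : u.im = 0)
    (hu0 : u.re ≠ 0) (hv0 : v.re ≠ 0) : JumpFormula u v u' v' := by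
  have hre : (u * v).re = u.re * v.re := by simp [hi]
  have him : (u * v).im = u.re * v.im := by simp [hi]
  have hu' := ne_zero_of_sgn_eq hu0 (hu.1 hu0)
  have hv' := ne_zero_of_sgn_eq hv0 (hv.1 hv0)
  have hq : quadSign u = 0 := by rw [quadSign, hi, mul_zero, sgn_zero]
  have hax : axisSign u = 1 := by simp [axisSign, hi, hu0]
  unfold JumpFormula
  by_cases hvi : v.im = 0
  · have h := quadSign_mul_of_near_real hu' hv' (by
      rw [huv.1 (by rw [hre]; exact mul_ne_zero hu0 hv0), hre, sgn_mul_eq, sgn_mul_eq,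
        hu.1 hu0, hv.1 hv0])
    have h1 : axisSign v = 1 := by simp [axisSign, hvi, hv0]
    have h2 : axisSign (u * v) = 1 := by simp only [axisSign, hre, him, hvi]; simp [hu0, hv0]
    rw [h1, h2, hax, angleDefect, angleDefect, hq]
    linear_combination h
  -- Here `v` and `uv` lie in open quadrants, so only `u` jumps; its jump is matched by the defect
  -- at `u'`, `v'`, because `quadSign v'` squares to 1.
  · have h1 : axisSign v = 0 := by simp [axisSign, hvi, hv0]
    have h2 : axisSign (u * v) = 0 := by simp only [axisSign, hre, him]; simp [hu0, hv0, hvi]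
    have h3 : quadSign (u' * v') = quadSign v' := by
      rw [huv.quadSign_eq (by rw [hre]; exact mul_ne_zero hu0 hv0)
        (by rw [him]; exact mul_ne_zero hu0 hvi), hv.quadSign_eq hv0 hvi, quadSign, quadSign,
        hre, him, sgn_mul_eq, sgn_mul_eq, sgn_mul_eq, sgn_mul_eq]
      linear_combination (sgn v.re * sgn v.im) * sgn_mul_self hu0
    have h4 : quadSign v' * quadSign v' = 1 := by
      rw [hv.quadSign_eq hv0 hvi]; exact sgn_mul_self (mul_ne_zero hv0 hvi)
    rw [h1, h2, hax, angleDefect, angleDefect, hq, h3]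
    linear_combination (quadSign u') * h4

theorem jumpFormula_of_im_eq_zero_left {u v u' v' : Cplx R} (hu : SignAdherent u u')
    (hv : SignAdherent v v') (huv : SignAdherent (u * v) (u' * v')) (hi : u.im = 0)
    (hu0 : u.re ≠ 0) (hv0 : v ≠ 0) : JumpFormula u v u' v' := by
  by_cases hv1 : v.re = 0
  · have hv2 : v.im ≠ 0 := fun h => hv0 (QuadraticAlgebra.ext hv1 h)
    refine (JumpFormula.of_imUnit_mul (JumpFormula.symm ?_)).symm
    refine jumpFormula_of_im_eq_zero hu hv.imUnit_mul ?_ hi hu0 ?_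
    · rw [mul_left_comm, mul_left_comm u']; exact huv.imUnit_mul
    · rw [re_imUnit_mul]; exact neg_ne_zero.2 hv2
  · exact jumpFormula_of_im_eq_zero hu hv huv hi hu0 hv1

theorem jumpFormula_of_mem_axes {u v u' v' : Cplx R} (hu : SignAdherent u u')
    (hv : SignAdherent v v') (huv : SignAdherent (u * v) (u' * v')) (hi : u.re = 0 ∨ u.im = 0)
    (hu0 : u ≠ 0) (hv0 : v ≠ 0) : JumpFormula u v u' v' := by
  rcases hi with hi | hi
  · have hu2 : u.im ≠ 0 := fun h => hu0 (QuadraticAlgebra.ext hi h)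
    refine JumpFormula.of_imUnit_mul ?_
    refine jumpFormula_of_im_eq_zero_left hu.imUnit_mul hv ?_ ?_ ?_ hv0
    · rw [mul_assoc, mul_assoc]; exact huv.imUnit_mul
    · rw [im_imUnit_mul, hi]
    · rw [re_imUnit_mul]; exact neg_ne_zero.2 hu2
  · exact jumpFormula_of_im_eq_zero_left hu hv huv hi
      (fun h => hu0 (QuadraticAlgebra.ext h hi)) hv0

/-- Once the cases with a factor on an axis are settled, only the product can jump. If `uv` is on an
axis, the vanishing coordinate determines `quadSign u * quadSign v`: it is 1 on the imaginary axis
and -1 on the real one. -/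
theorem jumpFormula {u v u' v' : Cplx R} (hu : SignAdherent u u')
    (hv : SignAdherent v v') (huv : SignAdherent (u * v) (u' * v'))
    (hu0 : u ≠ 0) (hv0 : v ≠ 0) : JumpFormula u v u' v' := by
  by_cases h1 : u.re = 0 ∨ u.im = 0
  · exact jumpFormula_of_mem_axes hu hv huv h1 hu0 hv0
  by_cases h2 : v.re = 0 ∨ v.im = 0
  · exact (jumpFormula_of_mem_axes hv hu (by rwa [mul_comm v u, mul_comm v' u']) h2 hv0 hu0).symm
  push Not at h1 h2
  obtain ⟨hur, hui⟩ := h1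
  obtain ⟨hvr, hvi⟩ := h2
  have hau : axisSign u = 0 := by simp [axisSign, hur, hui]
  have hav : axisSign v = 0 := by simp [axisSign, hvr, hvi]
  have hre : (u * v).re = u.re * v.re - u.im * v.im := by simp; ring
  have him : (u * v).im = u.re * v.im + u.im * v.re := by simp
  unfold JumpFormula
  rw [hau, hav, angleDefect, angleDefect, hu.quadSign_eq hur hui, hv.quadSign_eq hvr hvi]
  by_cases h3 : (u * v).re = 0
  · have h4 : (u * v).im ≠ 0 := by
      intro h4
      have h5 : u * v = 0 := QuadraticAlgebra.ext h3 h4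
      rcases mul_eq_zero.1 h5 with h | h
      · exact hu0 h
      · exact hv0 h
    have h5 : axisSign (u * v) = -1 := by rw [axisSign, if_neg h4, if_pos h3]; norm_num
    have h6 : quadSign (u * v) = 0 := by rw [quadSign, h3, zero_mul, sgn_zero]
    have h7 : quadSign u * quadSign v = 1 := by
      rw [quadSign, quadSign, ← sgn_mul_eq, sgn_of_pos]
      have : u.re * u.im * (v.re * v.im) = (u.re * v.re) * (u.re * v.re) := by
        rw [hre] at h3; linear_combination (-u.re * v.re) * h3
      rw [this]; exact mul_self_pos.2 (mul_ne_zero hur hvr)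
    rw [h5, h6]
    linear_combination (quadSign (u' * v')) * h7
  · by_cases h4 : (u * v).im = 0
    · have h5 : axisSign (u * v) = 1 := by rw [axisSign, if_pos h4, if_neg h3]; norm_num
      have h6 : quadSign (u * v) = 0 := by rw [quadSign, h4, mul_zero, sgn_zero]
      have h7 : quadSign u * quadSign v = -1 := by
        rw [quadSign, quadSign, ← sgn_mul_eq, sgn_of_neg]
        have : u.re * u.im * (v.re * v.im) = -((u.re * v.im) * (u.re * v.im)) := by
          rw [him] at h4; linear_combination (u.re * v.im) * h4
        rw [this]; exact neg_neg_of_pos (mul_self_pos.2 (mul_ne_zero hur hvi))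
      rw [h5, h6]
      linear_combination (quadSign (u' * v')) * h7
    · have h5 : axisSign (u * v) = 0 := by rw [axisSign, if_neg h4, if_neg h3]; norm_num
      rw [h5, huv.quadSign_eq h3 h4]
      ring

end Quadrants

theorem cofactor_zero {R : Type*} [Field R] (x : R) : cofactor x (0 : R[X]) = 0 := by
  simp [cofactor]

theorem pow_mul_cofactor {R : Type*} [Field R] (x : R) (P : R[X]) :
    (X - C x) ^ P.rootMultiplicity x * cofactor x P = P :=
  pow_mul_divByMonic_rootMultiplicity_eq P x

theorem cofactor_eq_self {R : Type*} [Field R] {x : R} {P : R[X]} (h : P.eval x ≠ 0) :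
    cofactor x P = P := by
  rw [cofactor, rootMultiplicity_eq_zero h, pow_zero, divByMonic_one]

/-! ### Signs of a polynomial immediately to the left and right of a point. -/

section OneSidedSigns

variable {R : Type*} [Field R] [LinearOrder R]

/-- The sign of `P` immediately to the right of `x`. -/
noncomputable def sgnRight (x : R) (P : R[X]) : ℚ := sgn ((cofactor x P).eval x)

/-- The sign of `P` immediately to the left of `x`. -/
noncomputable def sgnLeft (x : R) (P : R[X]) : ℚ :=
  (-1) ^ P.rootMultiplicity x * sgn ((cofactor x P).eval x)

theorem sgnRight_zero (x : R) : sgnRight x (0 : R[X]) = 0 := by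
  rw [sgnRight, cofactor_zero, eval_zero, sgn_zero]

theorem sgnLeft_zero (x : R) : sgnLeft x (0 : R[X]) = 0 := by
  rw [sgnLeft, cofactor_zero, eval_zero, sgn_zero, mul_zero]

theorem sgnRight_of_ne_zero {x : R} {P : R[X]} (h : P.eval x ≠ 0) :
    sgnRight x P = sgn (P.eval x) := by
  rw [sgnRight, cofactor_eq_self h]

theorem sgnLeft_of_ne_zero {x : R} {P : R[X]} (h : P.eval x ≠ 0) :
    sgnLeft x P = sgn (P.eval x) := by
  rw [sgnLeft, cofactor_eq_self h, rootMultiplicity_eq_zero h, pow_zero, one_mul]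

theorem exists_gt_forall_le_or_lt [IsStrictOrderedRing R] (x : R) (T : Finset R) :
    ∃ y, x < y ∧ ∀ t ∈ T, t ≤ x ∨ y < t := by
  classical
  induction T using Finset.induction_on with
  | empty => exact ⟨x + 1, by simp⟩
  | insert s T _ ih =>
    obtain ⟨y, hy, hT⟩ := ih
    rcases le_or_gt s x with hs | hs
    · refine ⟨y, hy, fun t ht => ?_⟩
      rcases Finset.mem_insert.1 ht with rfl | ht
      · exact .inl hs
      · exact hT t ht
    · obtain ⟨z, hz, hz'⟩ := exists_between (lt_min hy hs)
      refine ⟨z, hz, fun t ht => ?_⟩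
      rcases Finset.mem_insert.1 ht with rfl | ht
      · exact .inr (lt_min_iff.1 hz').2
      · exact (hT t ht).imp_right (lt_min_iff.1 hz').1.trans

theorem exists_lt_forall_lt_or_le [IsStrictOrderedRing R] (x : R) (T : Finset R) :
    ∃ y, y < x ∧ ∀ t ∈ T, t < y ∨ x ≤ t := by
  classical
  obtain ⟨y, hy, hT⟩ := exists_gt_forall_le_or_lt (-x) (T.image Neg.neg)
  refine ⟨-y, by linarith, fun t ht => ?_⟩
  rcases hT (-t) (Finset.mem_image_of_mem _ ht) with h | h
  · exact .inr (by linarith)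
  · exact .inl (by linarith)

variable [IsStrictOrderedRing R] [IsRealClosed R]

/-- The endpoints may be roots of `P`. Removing the powers of `X - a` and `X - b` leaves `B` without
roots on the closed interval, and the removed powers contribute exactly the signs in the definition
of `sgnLeft`. -/
theorem sgnRight_eq_sgnLeft {a b : R} (hab : a < b) {P : R[X]} (hP : P ≠ 0)
    (h : ∀ x ∈ Set.Ioo a b, P.eval x ≠ 0) : sgnRight a P = sgnLeft b P := by
  have hAP := pow_mul_cofactor a P
  have hAa := eval_cofactor_ne_zero a hP
  set A := cofactor a P with hA
  have hA0 : A ≠ 0 := by rintro h0; simp [h0] at hAa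
  have hBA := pow_mul_cofactor b A
  have hBb := eval_cofactor_ne_zero b hA0
  set B := cofactor b A with hB
  have hroot : ((X - C a : R[X]) ^ P.rootMultiplicity a).eval b ≠ 0 := by
    rw [eval_pow, eval_sub, eval_X, eval_C]; exact pow_ne_zero _ (sub_ne_zero.2 hab.ne')
  have hK0 : (X - C a : R[X]) ^ P.rootMultiplicity a ≠ 0 := pow_ne_zero _ (X_sub_C_ne_zero a)
  have hmult : P.rootMultiplicity b = A.rootMultiplicity b := by
    conv_lhs => rw [← hAP]
    rw [rootMultiplicity_mul (mul_ne_zero hK0 hA0), rootMultiplicity_eq_zero hroot, zero_add]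
  have hcof : cofactor b P = (X - C a) ^ P.rootMultiplicity a * B := by
    conv_lhs => rw [← hAP]
    rw [cofactor_mul b hK0 hA0, cofactor_eq_self hroot]
  have hAx : ∀ x, P.eval x = (x - a) ^ P.rootMultiplicity a * A.eval x := fun x => by
    conv_lhs => rw [← hAP]
    simp
  have hBx : ∀ x, A.eval x = (x - b) ^ A.rootMultiplicity b * B.eval x := fun x => by
    conv_lhs => rw [← hBA]
    simp
  have hsame : sgn (B.eval a) = sgn (B.eval b) := by
    refine sgn_eq_of_mul_pos (IsRealClosed.eval_mul_eval_pos hab.le fun x hx => ?_)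
    rcases eq_or_lt_of_le hx.1 with rfl | hx1
    · intro h0; exact hAa (by rw [hBx, h0, mul_zero])
    rcases eq_or_lt_of_le hx.2 with rfl | hx2
    · exact hBb
    · intro h0; exact h x ⟨hx1, hx2⟩ (by rw [hAx, hBx, h0, mul_zero, mul_zero])
  rw [sgnRight, sgnLeft, ← hA, hBx, hcof, hmult, eval_mul, eval_pow, eval_sub, eval_X, eval_C,
    sgn_mul_eq, sgn_mul_eq, sgn_pow, sgn_pow, sgn_of_neg (sub_neg.2 hab),
    sgn_of_pos (sub_pos.2 hab), one_pow, one_mul, hsame]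

end OneSidedSigns

/-! ### A common description of the two sides of a point. -/

section Sides

variable {R : Type*} [Field R] [LinearOrder R]

/-- The data `τ` (signs of polynomials) and `ind` (indices of pairs) describe one of the two sides
of the point `x`. -/
structure IsSide (x : R) (τ : R[X] → ℚ) (ind : R[X] → R[X] → ℚ) : Prop where
  sgn_of_ne_zero : ∀ {P : R[X]}, P.eval x ≠ 0 → τ P = sgn (P.eval x)
  mul_self : ∀ {P : R[X]}, P ≠ 0 → τ P * τ P = 1
  exists_eval : ∀ S : Finset R[X], ∃ y, ∀ P ∈ S, τ P = sgn (P.eval y)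
  ind_mul : ∀ {K : R[X]}, K ≠ 0 → ∀ P Q, ind (K * P) (K * Q) = ind P Q
  ind_of_eval_eq_zero : ∀ {P Q : R[X]}, P.eval x ≠ 0 → Q.eval x = 0 → ind P Q = 1 / 2 * (τ P * τ Q)
  ind_of_eval_ne_zero : ∀ {P Q : R[X]}, Q.eval x ≠ 0 → ind P Q = 0

variable [IsStrictOrderedRing R] [IsRealClosed R]

theorem isSide_right (x : R) : IsSide x (sgnRight x) (indRight x) where
  sgn_of_ne_zero := sgnRight_of_ne_zero
  mul_self hP := sgn_mul_self (eval_cofactor_ne_zero x hP)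
  exists_eval S := by
    classical
    obtain ⟨y, hy, hT⟩ := exists_gt_forall_le_or_lt x (S.biUnion fun P => P.roots.toFinset)
    refine ⟨y, fun P hP => ?_⟩
    by_cases h0 : P = 0
    · rw [h0, sgnRight_zero, eval_zero, sgn_zero]
    have hr : ∀ z, x < z → z ≤ y → P.eval z ≠ 0 := fun z h1 h2 hz => by
      have : z ∈ S.biUnion fun P => P.roots.toFinset :=
        Finset.mem_biUnion.2 ⟨P, hP, by simp [h0, hz]⟩
      rcases hT z this with h | h
      · exact absurd h1 h.not_gt
      · exact absurd h2 h.not_ge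
    rw [sgnRight_eq_sgnLeft hy h0 fun z hz => hr z hz.1 hz.2.le,
      sgnLeft_of_ne_zero (hr y hy le_rfl)]
  ind_mul hK P Q := indRight_mul x hK P Q
  ind_of_eval_eq_zero {P Q} hP hQ := by
    have hP0 : P ≠ 0 := by rintro rfl; simp at hP
    -- The index of a pair containing 0 is 0, which agrees with the formula because the sign of 0 is
    -- 0.
    by_cases hQ0 : Q = 0
    · simp [indRight, hQ0, sgnRight_zero]
    have hv : val x P Q < 0 := by
      have := (rootMultiplicity_pos hQ0).2 hQ
      rw [val, rootMultiplicity_eq_zero hP]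
      omega
    rw [indRight, if_pos ⟨hP0, hQ0, hv⟩, sgn_mul_eq, sgnRight, sgnRight]
  ind_of_eval_ne_zero {P Q} hQ := by
    rw [indRight, if_neg]
    rintro ⟨-, -, hv⟩
    rw [val, rootMultiplicity_eq_zero hQ] at hv
    omega

theorem isSide_left (x : R) : IsSide x (sgnLeft x) (indLeft x) where
  sgn_of_ne_zero := sgnLeft_of_ne_zero
  mul_self {P} hP := by
    have h1 : (-1 : ℚ) ^ P.rootMultiplicity x * (-1) ^ P.rootMultiplicity x = 1 := by
      rw [← mul_pow]; norm_num
    rw [sgnLeft, mul_mul_mul_comm, h1, one_mul, sgn_mul_self (eval_cofactor_ne_zero x hP)]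
  exists_eval S := by
    classical
    obtain ⟨y, hy, hT⟩ := exists_lt_forall_lt_or_le x (S.biUnion fun P => P.roots.toFinset)
    refine ⟨y, fun P hP => ?_⟩
    by_cases h0 : P = 0
    · rw [h0, sgnLeft_zero, eval_zero, sgn_zero]
    have hr : ∀ z, y ≤ z → z < x → P.eval z ≠ 0 := fun z h1 h2 hz => by
      have : z ∈ S.biUnion fun P => P.roots.toFinset :=
        Finset.mem_biUnion.2 ⟨P, hP, by simp [h0, hz]⟩
      rcases hT z this with h | h
      · exact absurd h1 h.not_ge
      · exact absurd h2 h.not_gt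
    rw [← sgnRight_eq_sgnLeft hy h0 fun z hz => hr z hz.1.le hz.2,
      sgnRight_of_ne_zero (hr y le_rfl hy)]
  ind_mul hK P Q := indLeft_mul x hK P Q
  ind_of_eval_eq_zero {P Q} hP hQ := by
    have hP0 : P ≠ 0 := by rintro rfl; simp at hP
    by_cases hQ0 : Q = 0
    · simp [indLeft, hQ0, sgnLeft_zero]
    have hm := rootMultiplicity_eq_zero hP
    have hv : val x P Q < 0 := by
      have := (rootMultiplicity_pos hQ0).2 hQ
      rw [val, hm]
      omega
    have hpow : (-1 : ℚ) ^ val x P Q = (-1) ^ Q.rootMultiplicity x := by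
      rw [val, hm, Nat.cast_zero, zero_sub, zpow_neg, zpow_natCast, ← inv_pow]
      norm_num
    rw [indLeft, if_pos ⟨hP0, hQ0, hv⟩, sgn_mul_eq, sgnLeft, sgnLeft, hpow, hm]
    ring
  ind_of_eval_ne_zero {P Q} hQ := by
    rw [indLeft, if_neg]
    rintro ⟨-, -, hv⟩
    rw [val, rootMultiplicity_eq_zero hQ] at hv
    omega

end Sides

/-! ### The jump of the coarse angle at one side of a point. -/

section LocalIndex

/-- Polynomials in one real variable with values in `R[i]`, as pairs of real polynomials. -/
abbrev CplxPoly (R : Type*) [Field R] : Type _ := QuadraticAlgebra R[X] (-1) 0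

variable {R : Type*} [Field R]

/-- The value of `f` at the point `x` of the line. -/
def CplxPoly.evalAt (x : R) (f : CplxPoly R) : Cplx R := ⟨f.re.eval x, f.im.eval x⟩

theorem CplxPoly.evalAt_mul (x : R) (f g : CplxPoly R) :
    (f * g).evalAt x = f.evalAt x * g.evalAt x := by
  ext <;> simp [evalAt]

/-- Take `K` to be the gcd of the two parts; by Bézout the quotients have no common root. -/
theorem CplxPoly.exists_eq_smul (x : R) {f : CplxPoly R} (hf : f ≠ 0) :
    ∃ (K : R[X]) (p : CplxPoly R), K ≠ 0 ∧ f = K • p ∧ p.evalAt x ≠ 0 := by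
  classical
  have hg : EuclideanDomain.gcd f.re f.im ≠ 0 := by
    rw [Ne, EuclideanDomain.gcd_eq_zero_iff]
    exact fun h => hf (QuadraticAlgebra.ext h.1 h.2)
  have hb := EuclideanDomain.gcd_eq_gcd_ab f.re f.im
  have h1 := EuclideanDomain.mul_div_cancel' hg (EuclideanDomain.gcd_dvd_left f.re f.im)
  have h2 := EuclideanDomain.mul_div_cancel' hg (EuclideanDomain.gcd_dvd_right f.re f.im)
  set K := EuclideanDomain.gcd f.re f.im
  refine ⟨K, ⟨f.re / K, f.im / K⟩, hg, QuadraticAlgebra.ext h1.symm h2.symm, fun h => ?_⟩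
  have h3 : (f.re / K).eval x = 0 := congrArg QuadraticAlgebra.re h
  have h4 : (f.im / K).eval x = 0 := congrArg QuadraticAlgebra.im h
  have h5 : 1 = f.re / K * EuclideanDomain.gcdA f.re f.im
      + f.im / K * EuclideanDomain.gcdB f.re f.im := by
    apply mul_left_cancel₀ hg
    linear_combination hb - EuclideanDomain.gcdA f.re f.im * h1
      - EuclideanDomain.gcdB f.re f.im * h2
  have h6 := congrArg (eval x) h5
  simp [h3, h4] at h6

/-- The contribution to the winding number of `f` of one side of a point, given the index of pairs
at that side. -/
noncomputable def sideIndex (ind : R[X] → R[X] → ℚ) (f : CplxPoly R) : ℚ := ind f.re f.im + ind (-f.im) f.re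

/-- The angle defect of `f` and `g` at one side of a point, given the signs of polynomials at that
side. -/
noncomputable def sideDefect (τ : R[X] → ℚ) (f g : CplxPoly R) : ℚ :=
  -(1 / 2) * (τ f.re * τ f.im * (τ g.re * τ g.im) * (τ (f * g).re * τ (f * g).im))

theorem sideDefect_comm (τ : R[X] → ℚ) (f g : CplxPoly R) :
    sideDefect τ f g = sideDefect τ g f := by
  rw [sideDefect, sideDefect, mul_comm g f]; ring

variable [LinearOrder R]

theorem IsSide.sideIndex_smul {x : R} {τ : R[X] → ℚ} {ind : R[X] → R[X] → ℚ} (h : IsSide x τ ind)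
    {K : R[X]} (hK : K ≠ 0) (f : CplxPoly R) : sideIndex ind (K • f) = sideIndex ind f := by
  simp only [sideIndex, QuadraticAlgebra.re_smul, QuadraticAlgebra.im_smul, smul_eq_mul,
    ← mul_neg, h.ind_mul hK]

theorem IsSide.signAdherent {x : R} {τ : R[X] → ℚ} {ind : R[X] → R[X] → ℚ} (h : IsSide x τ ind)
    {f : CplxPoly R} {y : R} (h1 : τ f.re = sgn (f.re.eval y))
    (h2 : τ f.im = sgn (f.im.eval y)) : SignAdherent (f.evalAt x) (f.evalAt y) :=
  ⟨fun h0 => h1.symm.trans (h.sgn_of_ne_zero h0), fun h0 => h2.symm.trans (h.sgn_of_ne_zero h0)⟩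

variable [IsStrictOrderedRing R]

theorem IsSide.sideIndex_eq {x : R} {τ : R[X] → ℚ} {ind : R[X] → R[X] → ℚ} (h : IsSide x τ ind)
    {f : CplxPoly R} (hf : f.evalAt x ≠ 0) {y : R} (h1 : τ f.re = sgn (f.re.eval y))
    (h2 : τ f.im = sgn (f.im.eval y)) (h3 : τ (-f.im) = sgn ((-f.im).eval y)) :
    sideIndex ind f = 1 / 2 * (quadSign (f.evalAt y) * axisSign (f.evalAt x)) := by
  have hq : quadSign (f.evalAt y) = τ f.re * τ f.im := by
    rw [h1, h2, ← sgn_mul_eq]; rfl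
  have hm : τ (-f.im) = -τ f.im := by rw [h3, h2, eval_neg, sgn_neg]
  rw [sideIndex, hq, axisSign]
  change _ = 1 / 2 * (_ * ((if f.im.eval x = 0 then 1 else 0) - if f.re.eval x = 0 then 1 else 0))
  by_cases hr : f.re.eval x = 0
  · have hi : f.im.eval x ≠ 0 := fun hi => hf (QuadraticAlgebra.ext hr hi)
    rw [h.ind_of_eval_ne_zero hi, h.ind_of_eval_eq_zero (by simpa using hi) hr, if_neg hi,
      if_pos hr, hm]
    ring
  · rw [h.ind_of_eval_ne_zero hr, if_neg hr]
    by_cases hi : f.im.eval x = 0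
    · rw [h.ind_of_eval_eq_zero hr hi, if_pos hi]; ring
    · rw [h.ind_of_eval_ne_zero hi, if_neg hi]; ring

theorem IsSide.map_mul {x : R} {τ : R[X] → ℚ} {ind : R[X] → R[X] → ℚ} (h : IsSide x τ ind)
    (P Q : R[X]) : τ (P * Q) = τ P * τ Q := by
  classical
  obtain ⟨y, hy⟩ := h.exists_eval {P, Q, P * Q}
  simp only [Finset.mem_insert, Finset.mem_singleton, forall_eq_or_imp, forall_eq] at hy
  obtain ⟨h1, h2, h3⟩ := hy
  rw [h1, h2, h3, eval_mul, sgn_mul_eq]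

theorem IsSide.sideDefect_smul {x : R} {τ : R[X] → ℚ} {ind : R[X] → R[X] → ℚ}
    (h : IsSide x τ ind) {K : R[X]} (hK : K ≠ 0) (f g : CplxPoly R) :
    sideDefect τ (K • f) g = sideDefect τ f g := by
  have h1 := h.mul_self hK
  simp only [sideDefect, smul_mul_assoc, QuadraticAlgebra.re_smul, QuadraticAlgebra.im_smul,
    smul_eq_mul, h.map_mul]
  -- The sign of `K` enters four times, through both parts of `f` and of `f * g`; the cofactor comes
  -- from `k ^ 4 - 1 = (k ^ 2 + 1) * (k ^ 2 - 1)`.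
  linear_combination (-(1 / 2) * (τ f.re * τ f.im * (τ g.re * τ g.im) *
    (τ (f * g).re * τ (f * g).im))) * (τ K * τ K + 1) * h1

/-- A single nearby point `y` realizes all the one-sided signs at once, and `jumpFormula` applies to
the values at `x` and at `y`. -/
theorem IsSide.sideIndex_mul {x : R} {τ : R[X] → ℚ} {ind : R[X] → R[X] → ℚ}
    (h : IsSide x τ ind) {f g : CplxPoly R} (hf : f.evalAt x ≠ 0) (hg : g.evalAt x ≠ 0) :
    sideIndex ind (f * g) = sideIndex ind f + sideIndex ind g
      + (sideDefect τ f g - angleDefect (f.evalAt x) (g.evalAt x)) := by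
  classical
  obtain ⟨y, hy⟩ := h.exists_eval {f.re, f.im, -f.im, g.re, g.im, -g.im, (f * g).re, (f * g).im,
    -(f * g).im}
  simp only [Finset.mem_insert, Finset.mem_singleton, forall_eq_or_imp, forall_eq] at hy
  obtain ⟨h1, h2, h3, h4, h5, h6, h7, h8, h9⟩ := hy
  have hfg : (f * g).evalAt x ≠ 0 := by rw [CplxPoly.evalAt_mul]; exact mul_ne_zero hf hg
  have hj := jumpFormula (h.signAdherent h1 h2) (h.signAdherent h4 h5)
    (by rw [← CplxPoly.evalAt_mul, ← CplxPoly.evalAt_mul]; exact h.signAdherent h7 h8) hf hg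
  have hd : sideDefect τ f g = angleDefect (f.evalAt y) (g.evalAt y) := by
    rw [sideDefect, angleDefect, ← CplxPoly.evalAt_mul, h1, h2, h4, h5, h7, h8]
    simp only [← sgn_mul_eq, quadSign]
    rfl
  rw [h.sideIndex_eq hf h1 h2 h3, h.sideIndex_eq hg h4 h5 h6, h.sideIndex_eq hfg h7 h8 h9, hd,
    CplxPoly.evalAt_mul, CplxPoly.evalAt_mul]
  unfold JumpFormula at hj
  linear_combination (1 / 2) * hj

theorem IsSide.sideIndex_smul_mul_smul {x : R} {τ : R[X] → ℚ} {ind : R[X] → R[X] → ℚ}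
    (h : IsSide x τ ind) {K L : R[X]} (hK : K ≠ 0) (hL : L ≠ 0) {f g : CplxPoly R}
    (hf : f.evalAt x ≠ 0) (hg : g.evalAt x ≠ 0) :
    sideIndex ind ((K • f) * (L • g)) = sideIndex ind (K • f) + sideIndex ind (L • g)
      + (sideDefect τ (K • f) (L • g) - angleDefect (f.evalAt x) (g.evalAt x)) := by
  rw [smul_mul_smul_comm, h.sideIndex_smul (mul_ne_zero hK hL), h.sideIndex_smul hK,
    h.sideIndex_smul hL, h.sideIndex_mul hf hg, h.sideDefect_smul hK, sideDefect_comm τ f (L • g),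
    h.sideDefect_smul hL, sideDefect_comm τ g f]

end LocalIndex

/-! ### Telescoping for piecewise constant functions. -/

theorem add_sum_sub_eq_of_piecewise_constant {R M : Type*} [LinearOrder R] [AddCommGroup M]
    {D D' : R → M} {S : Finset R}
    (hS : ∀ a b, a < b → (∀ x ∈ S, ¬ (a < x ∧ x < b)) → D a = D' b) {a b : R} (hab : a < b) :
    D a + ∑ x ∈ S with a < x ∧ x < b, (D x - D' x) = D' b := by
  obtain ⟨n, hn⟩ : ∃ n, (S.filter fun x => a < x ∧ x < b).card = n := ⟨_, rfl⟩
  induction n using Nat.strong_induction_on generalizing b with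
  | h n ih =>
    rcases (S.filter fun x => a < x ∧ x < b).eq_empty_or_nonempty with he | he
    · rw [he, Finset.sum_empty, add_zero]
      exact hS a b hab fun x hx h => Finset.notMem_empty x (he ▸ Finset.mem_filter.2 ⟨hx, h⟩)
    -- Split at the last breakpoint `c`: the induction hypothesis handles the part before it, and
    -- after it nothing changes.
    · set c := (S.filter fun x => a < x ∧ x < b).max' he
      obtain ⟨hcS, hac, hcb⟩ := Finset.mem_filter.1 (Finset.max'_mem _ he)
      have hlast : ∀ x ∈ S, a < x → x < b → x ≤ c := fun x hx h1 h2 =>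
        Finset.le_max' _ x (Finset.mem_filter.2 ⟨hx, h1, h2⟩)
      have hins : (S.filter fun x => a < x ∧ x < b)
          = insert c (S.filter fun x => a < x ∧ x < c) := by
        ext x
        simp only [Finset.mem_insert, Finset.mem_filter]
        constructor
        · rintro ⟨hx, h1, h2⟩
          rcases eq_or_lt_of_le (hlast x hx h1 h2) with h | h
          · exact .inl h
          · exact .inr ⟨hx, h1, h⟩
        · rintro (rfl | ⟨hx, h1, h2⟩)
          · exact ⟨hcS, hac, hcb⟩
          · exact ⟨hx, h1, h2.trans hcb⟩
      have hnot : c ∉ S.filter fun x => a < x ∧ x < c := by simp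
      have hlt : (S.filter fun x => a < x ∧ x < c).card < n := by
        rw [← hn, hins, Finset.card_insert_of_notMem hnot]; exact Nat.lt_succ_self _
      have h1 := ih _ hlt hac rfl
      have h2 : D c = D' b := hS c b hcb fun x hx h =>
        (hlast x hx (hac.trans h.1) h.2).not_gt h.1
      rw [hins, Finset.sum_insert hnot, ← h2, add_left_comm, h1, sub_add_cancel]

theorem add_finsum_sub_eq_of_piecewise_constant {R M : Type*} [LinearOrder R] [AddCommGroup M]
    {D D' : R → M} {S : Finset R} (hpt : ∀ x ∉ S, D x = D' x)
    (hS : ∀ a b, a < b → (∀ x ∈ S, ¬ (a < x ∧ x < b)) → D a = D' b) {a b : R} (hab : a < b) :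
    (Function.support fun x => D x - D' x).Finite ∧
      D a + ∑ᶠ x ∈ Set.Ioo a b, (D x - D' x) = D' b := by
  have hsupp : (Function.support fun x => D x - D' x) ⊆ S := fun x hx => by
    by_contra h
    exact hx (sub_eq_zero.2 (hpt x h))
  refine ⟨S.finite_toSet.subset hsupp, ?_⟩
  rw [finsum_mem_eq_sum_of_inter_support_eq (t := S.filter fun x => a < x ∧ x < b)]
  · exact add_sum_sub_eq_of_piecewise_constant hS hab
  · ext x
    simp only [Set.mem_inter_iff, Set.mem_Ioo, Finset.coe_filter, Set.mem_ofPred_eq]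
    exact ⟨fun h => ⟨⟨hsupp h.2, h.1⟩, h.2⟩, fun h => ⟨h.1.2, h.2⟩⟩

/-! ### Variation of the coarse angle along an edge. -/

section EdgeIndex

variable {R : Type*} [Field R]

/-- The nonzero value `u` is that of `f` at `x` after removing a real polynomial factor of `f`. -/
def HasDirection (x : R) (f : CplxPoly R) (u : Cplx R) : Prop :=
  u ≠ 0 ∧ ∃ (K : R[X]) (p : CplxPoly R), K ≠ 0 ∧ f = K • p ∧ p.evalAt x = u

theorem HasDirection.ne_zero {x : R} {f : CplxPoly R} {u : Cplx R} (h : HasDirection x f u) :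
    f ≠ 0 := by
  obtain ⟨hu, K, p, hK, rfl, rfl⟩ := h
  intro h0
  have h1 : K * p.re = 0 := congrArg QuadraticAlgebra.re h0
  have h2 : K * p.im = 0 := congrArg QuadraticAlgebra.im h0
  apply hu
  have h3 := (mul_eq_zero.1 h1).resolve_left hK
  have h4 := (mul_eq_zero.1 h2).resolve_left hK
  ext <;> simp [CplxPoly.evalAt, h3, h4]

theorem exists_hasDirection (x : R) {f : CplxPoly R} (hf : f ≠ 0) : ∃ u, HasDirection x f u := by
  obtain ⟨K, p, hK, h, hp⟩ := CplxPoly.exists_eq_smul x hf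
  exact ⟨_, hp, K, p, hK, h, rfl⟩

variable [LinearOrder R]

/-- Four times the contribution of an edge `[a, b]` to the winding number. -/
noncomputable def edgeIndex (a b : R) (f : CplxPoly R) : ℚ :=
  cauchyInd a b f.re f.im + cauchyInd a b (-f.im) f.re

theorem edgeIndex_swap (a b : R) (f : CplxPoly R) : edgeIndex b a f = -edgeIndex a b f := by
  have h : ∀ P Q : R[X], cauchyInd b a P Q = -cauchyInd a b P Q := fun P Q => by
    unfold cauchyInd
    rcases lt_trichotomy a b with h | rfl | h
    · rw [if_neg h.not_gt, if_pos h, if_pos h]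
    · simp
    · rw [if_pos h, if_neg h.not_gt, if_pos h, neg_neg]
  rw [edgeIndex, edgeIndex, h, h]; ring

/-- The jump of the quadrant-valued angle of `f` at an interior point of an edge. -/
noncomputable def pointIndex (f : CplxPoly R) (x : R) : ℚ :=
  sideIndex (indRight x) f - sideIndex (indLeft x) f

theorem pointIndex_eq (f : CplxPoly R) :
    pointIndex f = (fun x => indAt x f.re f.im) + fun x => indAt x (-f.im) f.re := by
  funext x
  simp only [pointIndex, sideIndex, indAt, Pi.add_apply]; ring

theorem finite_support_pointIndex (f : CplxPoly R) : (Function.support (pointIndex f)).Finite := by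
  rw [pointIndex_eq]
  exact ((finite_support_indAt _ _).union (finite_support_indAt _ _)).subset
    (Function.support_add _ _)

theorem edgeIndex_of_lt {a b : R} (hab : a < b) (f : CplxPoly R) :
    edgeIndex a b f = sideIndex (indRight a) f + (∑ᶠ x ∈ Set.Ioo a b, pointIndex f x)
      - sideIndex (indLeft b) f := by
  have h : ∑ᶠ x ∈ Set.Ioo a b, pointIndex f x = ∑ᶠ x ∈ Set.Ioo a b, indAt x f.re f.im
      + ∑ᶠ x ∈ Set.Ioo a b, indAt x (-f.im) f.re := by
    rw [pointIndex_eq]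
    exact finsum_mem_add_distrib' ((finite_support_indAt _ _).inter_of_right _)
      ((finite_support_indAt _ _).inter_of_right _)
  rw [h, edgeIndex, cauchyInd, cauchyInd, if_pos hab, if_pos hab, indLt, indLt, sideIndex,
    sideIndex]
  ring

variable [IsStrictOrderedRing R]

theorem IsSide.sideIndex_mul_of_hasDirection {x : R} {τ : R[X] → ℚ} {ind : R[X] → R[X] → ℚ}
    (h : IsSide x τ ind) {f g : CplxPoly R} {u v : Cplx R} (hf : HasDirection x f u)
    (hg : HasDirection x g v) :
    sideIndex ind (f * g) = sideIndex ind f + sideIndex ind g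
      + (sideDefect τ f g - angleDefect u v) := by
  obtain ⟨hu, K, p, hK, rfl, rfl⟩ := hf
  obtain ⟨hv, L, q, hL, rfl, rfl⟩ := hg
  exact h.sideIndex_smul_mul_smul hK hL hu hv

variable [IsRealClosed R]

/-- The defect at `x` itself is the same seen from both sides and cancels, leaving only the
one-sided defects. -/
theorem pointIndex_mul {f g : CplxPoly R} (hf : f ≠ 0) (hg : g ≠ 0) (x : R) :
    pointIndex (f * g) x = pointIndex f x + pointIndex g x
      + (sideDefect (sgnRight x) f g - sideDefect (sgnLeft x) f g) := by
  obtain ⟨u, hu⟩ := exists_hasDirection x hf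
  obtain ⟨v, hv⟩ := exists_hasDirection x hg
  rw [pointIndex, pointIndex, pointIndex, (isSide_right x).sideIndex_mul_of_hasDirection hu hv,
    (isSide_left x).sideIndex_mul_of_hasDirection hu hv]
  ring

/-- The defect depends only on the signs of six polynomials, so it can change only at roots of the
nonzero ones. -/
theorem exists_finset_sideDefect_eq (f g : CplxPoly R) : ∃ S : Finset R,
    (∀ x ∉ S, sideDefect (sgnRight x) f g = sideDefect (sgnLeft x) f g) ∧
    ∀ a b, a < b → (∀ x ∈ S, ¬ (a < x ∧ x < b)) →
      sideDefect (sgnRight a) f g = sideDefect (sgnLeft b) f g := by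
  classical
  set T : Finset R[X] := {f.re, f.im, g.re, g.im, (f * g).re, (f * g).im} with hT
  have hcongr : ∀ σ τ : R[X] → ℚ, (∀ P ∈ T, σ P = τ P) → sideDefect σ f g = sideDefect τ f g := by
    intro σ τ h
    simp only [hT, Finset.mem_insert, Finset.mem_singleton, forall_eq_or_imp, forall_eq] at h
    obtain ⟨h1, h2, h3, h4, h5, h6⟩ := h
    rw [sideDefect, sideDefect, h1, h2, h3, h4, h5, h6]
  clear_value T
  have hmem : ∀ P ∈ T, P ≠ 0 → ∀ x, P.eval x = 0 → x ∈ T.biUnion fun P => P.roots.toFinset :=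
    fun P hP h0 x hx => Finset.mem_biUnion.2 ⟨P, hP, by simp [h0, hx]⟩
  refine ⟨T.biUnion fun P => P.roots.toFinset, fun x hx => ?_, fun a b hab h => ?_⟩ <;>
    refine hcongr _ _ fun P hP => ?_ <;> by_cases h0 : P = 0
  · rw [h0, sgnRight_zero, sgnLeft_zero]
  · have hPx : P.eval x ≠ 0 := fun h => hx (hmem P hP h0 x h)
    rw [sgnRight_of_ne_zero hPx, sgnLeft_of_ne_zero hPx]
  · rw [h0, sgnRight_zero, sgnLeft_zero]
  · exact sgnRight_eq_sgnLeft hab h0 fun x hx h1 => h x (hmem P hP h0 x h1) hx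

theorem sideDefect_add_finsum {a b : R} (hab : a < b) (f g : CplxPoly R) :
    (Function.support fun x => sideDefect (sgnRight x) f g - sideDefect (sgnLeft x) f g).Finite ∧
    sideDefect (sgnRight a) f g
      + ∑ᶠ x ∈ Set.Ioo a b, (sideDefect (sgnRight x) f g - sideDefect (sgnLeft x) f g)
      = sideDefect (sgnLeft b) f g := by
  obtain ⟨S, hpt, hS⟩ := exists_finset_sideDefect_eq f g
  exact add_finsum_sub_eq_of_piecewise_constant hpt hS hab

/-- The one-sided defects at interior points telescope against those at the ends of the edge. Only
the defects of the directions at `a` and `b` survive. -/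
theorem edgeIndex_mul {a b : R} (hab : a < b) {f g : CplxPoly R} {u v u' v' : Cplx R}
    (hu : HasDirection a f u) (hv : HasDirection a g v) (hu' : HasDirection b f u')
    (hv' : HasDirection b g v') :
    edgeIndex a b (f * g) = edgeIndex a b f + edgeIndex a b g
      + (angleDefect u' v' - angleDefect u v) := by
  obtain ⟨hfin, hsum⟩ := sideDefect_add_finsum hab f g
  have h1 : ∑ᶠ x ∈ Set.Ioo a b, pointIndex (f * g) x
      = ∑ᶠ x ∈ Set.Ioo a b, pointIndex f x + ∑ᶠ x ∈ Set.Ioo a b, pointIndex g x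
      + ∑ᶠ x ∈ Set.Ioo a b, (sideDefect (sgnRight x) f g - sideDefect (sgnLeft x) f g) := by
    simp only [pointIndex_mul hu.ne_zero hv.ne_zero]
    rw [finsum_mem_add_distrib' (Set.Finite.inter_of_right ?_ _) (hfin.inter_of_right _),
      finsum_mem_add_distrib' ((finite_support_pointIndex f).inter_of_right _)
        ((finite_support_pointIndex g).inter_of_right _)]
    exact ((finite_support_pointIndex f).union (finite_support_pointIndex g)).subset
      (Function.support_add _ _)
  rw [edgeIndex_of_lt hab, edgeIndex_of_lt hab, edgeIndex_of_lt hab, h1,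
    (isSide_right a).sideIndex_mul_of_hasDirection hu hv,
    (isSide_left b).sideIndex_mul_of_hasDirection hu' hv']
  linear_combination hsum

end EdgeIndex

/-! ### Restriction of bivariate polynomials to horizontal and vertical lines. -/

section Restriction

variable {R : Type*} [Field R]

theorem C_imUnit_mul_self (R : Type*) [Field R] :
    (MvPolynomial.C (imUnit R) : MvPolynomial (Fin 2) (Cplx R)) * MvPolynomial.C (imUnit R)
      = -1 := by
  rw [← map_mul, imUnit_mul_self, map_neg, map_one]

theorem rePart_mul_eq (F G : MvPolynomial (Fin 2) (Cplx R)) :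
    rePart (F * G) = rePart F * rePart G - imPart F * imPart G ∧
      imPart (F * G) = rePart F * imPart G + imPart F * rePart G := by
  have h : F * G = ofRealPoly (rePart F * rePart G - imPart F * imPart G)
      + MvPolynomial.C (imUnit R) * ofRealPoly (rePart F * imPart G + imPart F * rePart G) := by
    conv_lhs => rw [← re_add_im F, ← re_add_im G]
    simp only [ofRealPoly, map_add, map_sub, map_mul]
    linear_combination (MvPolynomial.map (algebraMap R (Cplx R)) (imPart F)
      * MvPolynomial.map (algebraMap R (Cplx R)) (imPart G)) * C_imUnit_mul_self R
  exact ⟨rePart_eq h, imPart_eq h⟩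

theorem rePart_conjPoly (F : MvPolynomial (Fin 2) (Cplx R)) :
    rePart (conjPoly F) = rePart F ∧ imPart (conjPoly F) = -imPart F := by
  have h : conjPoly F = ofRealPoly (rePart F)
      + MvPolynomial.C (imUnit R) * ofRealPoly (-imPart F) := by
    simp only [conjPoly, ofRealPoly, map_neg]; ring
  exact ⟨rePart_eq h, imPart_eq h⟩

theorem conjPoly_mul (F G : MvPolynomial (Fin 2) (Cplx R)) :
    conjPoly (F * G) = conjPoly F * conjPoly G := by
  obtain ⟨h1, h2⟩ := rePart_mul_eq F G
  simp only [conjPoly, h1, h2, ofRealPoly, map_add, map_sub, map_mul]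
  linear_combination (-(MvPolynomial.map (algebraMap R (Cplx R)) (imPart F)
    * MvPolynomial.map (algebraMap R (Cplx R)) (imPart G))) * C_imUnit_mul_self R

theorem rePart_imUnit_mul (F : MvPolynomial (Fin 2) (Cplx R)) :
    rePart (MvPolynomial.C (imUnit R) * F) = -imPart F ∧
      imPart (MvPolynomial.C (imUnit R) * F) = rePart F := by
  have h : MvPolynomial.C (imUnit R) * F = ofRealPoly (-imPart F)
      + MvPolynomial.C (imUnit R) * ofRealPoly (rePart F) := by
    conv_lhs => rw [← re_add_im F]
    simp only [ofRealPoly, map_neg]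
    linear_combination (MvPolynomial.map (algebraMap R (Cplx R)) (imPart F)) * C_imUnit_mul_self R
  exact ⟨rePart_eq h, imPart_eq h⟩

/-- The restriction of `F` to a horizontal line. -/
noncomputable def restrHorizontal (y : R) (F : MvPolynomial (Fin 2) (Cplx R)) : CplxPoly R :=
  ⟨onHorizontal y (rePart F), onHorizontal y (imPart F)⟩

/-- The restriction of `F` to a vertical line. -/
noncomputable def restrVertical (x : R) (F : MvPolynomial (Fin 2) (Cplx R)) : CplxPoly R :=
  ⟨onVertical x (rePart F), onVertical x (imPart F)⟩

theorem restrHorizontal_mul (y : R) (F G : MvPolynomial (Fin 2) (Cplx R)) :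
    restrHorizontal y (F * G) = restrHorizontal y F * restrHorizontal y G := by
  obtain ⟨h1, h2⟩ := rePart_mul_eq F G
  ext1 <;> simp [restrHorizontal, h1, h2, onHorizontal, sub_eq_add_neg]

theorem restrVertical_mul (x : R) (F G : MvPolynomial (Fin 2) (Cplx R)) :
    restrVertical x (F * G) = restrVertical x F * restrVertical x G := by
  obtain ⟨h1, h2⟩ := rePart_mul_eq F G
  ext1 <;> simp [restrVertical, h1, h2, onVertical, sub_eq_add_neg]

theorem restrHorizontal_conjPoly (y : R) (F : MvPolynomial (Fin 2) (Cplx R)) :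
    restrHorizontal y (conjPoly F) = star (restrHorizontal y F) := by
  obtain ⟨h1, h2⟩ := rePart_conjPoly F
  ext1 <;> simp [restrHorizontal, h1, h2, onHorizontal]

theorem restrVertical_conjPoly (x : R) (F : MvPolynomial (Fin 2) (Cplx R)) :
    restrVertical x (conjPoly F) = star (restrVertical x F) := by
  obtain ⟨h1, h2⟩ := rePart_conjPoly F
  ext1 <;> simp [restrVertical, h1, h2, onVertical]

theorem eval_onHorizontal (x y : R) (A : MvPolynomial (Fin 2) R) :
    (onHorizontal y A).eval x = MvPolynomial.eval ![x, y] A := by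
  rw [← coe_aeval_eq_eval, onHorizontal, ← AlgHom.comp_apply,
    MvPolynomial.comp_aeval, ← MvPolynomial.coe_aeval_eq_eval, RingHom.coe_coe]
  congr 2
  funext j; fin_cases j <;> simp

theorem eval_onVertical (x y : R) (A : MvPolynomial (Fin 2) R) :
    (onVertical x A).eval y = MvPolynomial.eval ![x, y] A := by
  rw [← coe_aeval_eq_eval, onVertical, ← AlgHom.comp_apply,
    MvPolynomial.comp_aeval, ← MvPolynomial.coe_aeval_eq_eval, RingHom.coe_coe]
  congr 2
  funext j; fin_cases j <;> simp

theorem eval_toXY_eq (x y : R) (F : (Cplx R)[X]) :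
    F.eval (⟨x, y⟩ : Cplx R) = ⟨MvPolynomial.eval ![x, y] (rePart (toXY F)),
      MvPolynomial.eval ![x, y] (imPart (toXY F))⟩ := by
  have h := eval_toXY ![x, y] F
  rw [← re_add_im (toXY F), map_add, map_mul, eval_ofRealPoly, eval_ofRealPoly] at h
  refine h.symm.trans ?_
  ext <;> simp [imUnit]

theorem evalAt_restrHorizontal_toXY (x y : R) (F : (Cplx R)[X]) :
    (restrHorizontal y (toXY F)).evalAt x = F.eval (⟨x, y⟩ : Cplx R) := by
  rw [eval_toXY_eq, CplxPoly.evalAt, restrHorizontal, eval_onHorizontal, eval_onHorizontal]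

theorem evalAt_restrVertical_toXY (x y : R) (F : (Cplx R)[X]) :
    (restrVertical x (toXY F)).evalAt y = F.eval (⟨x, y⟩ : Cplx R) := by
  rw [eval_toXY_eq, CplxPoly.evalAt, restrVertical, eval_onVertical, eval_onVertical]

theorem rePart_toXY_X_sub_C (x y : R) :
    rePart (toXY (X - C (⟨x, y⟩ : Cplx R))) = MvPolynomial.X 0 - MvPolynomial.C x ∧
      imPart (toXY (X - C (⟨x, y⟩ : Cplx R))) = MvPolynomial.X 1 - MvPolynomial.C y := by
  have hz : (⟨x, y⟩ : Cplx R) = algebraMap R (Cplx R) x + imUnit R * algebraMap R (Cplx R) y := by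
    ext <;> simp [imUnit]
  have h : toXY (X - C (⟨x, y⟩ : Cplx R)) = ofRealPoly (MvPolynomial.X 0 - MvPolynomial.C x)
      + MvPolynomial.C (imUnit R) * ofRealPoly (MvPolynomial.X 1 - MvPolynomial.C y) := by
    simp only [toXY, ofRealPoly, map_sub, aeval_X, aeval_C, MvPolynomial.map_X,
      MvPolynomial.map_C, MvPolynomial.algebraMap_eq]
    rw [hz, map_add, map_mul]
    ring
  exact ⟨rePart_eq h, imPart_eq h⟩

theorem HasDirection.mul {x : R} {f g : CplxPoly R} {u v : Cplx R}
    [NoZeroDivisors (Cplx R)] (hf : HasDirection x f u) (hg : HasDirection x g v) :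
    HasDirection x (f * g) (u * v) := by
  obtain ⟨hu, K, p, hK, rfl, rfl⟩ := hf
  obtain ⟨hv, L, q, hL, rfl, rfl⟩ := hg
  exact ⟨mul_ne_zero hu hv, K * L, p * q, mul_ne_zero hK hL, smul_mul_smul_comm K p L q,
    CplxPoly.evalAt_mul x p q⟩

theorem HasDirection.star {x : R} {f : CplxPoly R} {u : Cplx R} (hf : HasDirection x f u) :
    HasDirection x (star f) (star u) := by
  obtain ⟨hu, K, p, hK, rfl, rfl⟩ := hf
  refine ⟨star_ne_zero.2 hu, K, Star.star p, hK, ?_, ?_⟩ <;>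
    ext1 <;> simp [CplxPoly.evalAt]

end Restriction

theorem windBig_eq {R : Type*} [Field R] [LinearOrder R] (F : MvPolynomial (Fin 2) (Cplx R)) (x₀ x₁ y₀ y₁ : R) :
    windBig F x₀ x₁ y₀ y₁ = 1 / 4 * (edgeIndex x₀ x₁ (restrHorizontal y₀ F)
      + edgeIndex y₀ y₁ (restrVertical x₁ F) - edgeIndex x₀ x₁ (restrHorizontal y₁ F)
      - edgeIndex y₀ y₁ (restrVertical x₀ F)) := by
  obtain ⟨h1, h2⟩ := rePart_imUnit_mul F
  have hh : ∀ (y : R) A, onHorizontal y (-A) = -onHorizontal y A := fun y A => map_neg _ _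
  have hv : ∀ (x : R) A, onVertical x (-A) = -onVertical x A := fun x A => map_neg _ _
  rw [sub_eq_add_neg, sub_eq_add_neg, ← edgeIndex_swap x₀ x₁, ← edgeIndex_swap y₀ y₁, windBig,
    windSmall, windSmall, h1, h2, hh, hh, hv, hv]
  simp only [edgeIndex, restrHorizontal, restrVertical]
  ring

/-! ### Directions at the corners and cancellation around the rectangle. -/

section Corners

variable {R : Type*} [Field R] [LinearOrder R] [IsStrictOrderedRing R]

/-- At the corner `(x, y)` the directions of `F` along the two edges differ by a power of `i`. -/
def CornerCompatible (x y : R) (F : MvPolynomial (Fin 2) (Cplx R)) : Prop :=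
  ∃ (u : Cplx R) (m : ℕ), HasDirection x (restrHorizontal y F) u ∧
    HasDirection y (restrVertical x F) (imUnit R ^ m * u)

theorem CornerCompatible.mul {x y : R} {F G : MvPolynomial (Fin 2) (Cplx R)}
    (hF : CornerCompatible x y F) (hG : CornerCompatible x y G) : CornerCompatible x y (F * G) := by
  obtain ⟨u, m, h1, h2⟩ := hF
  obtain ⟨v, n, h3, h4⟩ := hG
  refine ⟨u * v, m + n, restrHorizontal_mul y F G ▸ h1.mul h3, ?_⟩
  rw [restrVertical_mul, pow_add, mul_mul_mul_comm]
  exact h2.mul h4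

theorem CornerCompatible.conjPoly {x y : R} {F : MvPolynomial (Fin 2) (Cplx R)}
    (hF : CornerCompatible x y F) : CornerCompatible x y (conjPoly F) := by
  obtain ⟨u, m, h1, h2⟩ := hF
  -- Conjugation turns `i` into `i ^ 3`.
  refine ⟨star u, 3 * m, restrHorizontal_conjPoly y F ▸ h1.star, ?_⟩
  have hs : star (imUnit R) = imUnit R ^ 3 := by
    rw [pow_succ, pow_two, imUnit_mul_self]
    ext <;> simp [imUnit]
  rw [restrVertical_conjPoly, pow_mul, ← hs, ← star_pow, mul_comm, ← star_mul]
  exact h2.star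

theorem cornerCompatible_of_eval_ne_zero {x y : R} {F : (Cplx R)[X]}
    (h : F.eval (⟨x, y⟩ : Cplx R) ≠ 0) : CornerCompatible x y (toXY F) := by
  refine ⟨_, 0, ⟨h, 1, _, one_ne_zero, (one_smul _ _).symm, evalAt_restrHorizontal_toXY x y F⟩, ?_⟩
  rw [pow_zero, one_mul]
  exact ⟨h, 1, _, one_ne_zero, (one_smul _ _).symm, evalAt_restrVertical_toXY x y F⟩

theorem cornerCompatible_X_sub_C (x y : R) :
    CornerCompatible x y (toXY (X - C (⟨x, y⟩ : Cplx R))) := by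
  obtain ⟨h1, h2⟩ := rePart_toXY_X_sub_C x y
  -- With `z = x + iy`, the polynomial `Z - z` restricts to `T - x` on the horizontal line and to `i
  -- (T - y)` on the vertical one, so the directions are `1` and `i`.
  refine ⟨1, 1, ⟨one_ne_zero, X - C x, 1, X_sub_C_ne_zero x, ?_, ?_⟩,
    ⟨?_, X - C y, ⟨0, 1⟩, X_sub_C_ne_zero y, ?_, ?_⟩⟩
  · ext1 <;> simp [restrHorizontal, onHorizontal, h1, h2, QuadraticAlgebra.re_one,
      QuadraticAlgebra.im_one]
  · ext <;> simp [CplxPoly.evalAt, QuadraticAlgebra.re_one, QuadraticAlgebra.im_one]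
  · intro h
    have := congrArg QuadraticAlgebra.im h
    simp [imUnit] at this
  · ext1 <;> simp [restrVertical, onVertical, h1, h2]
  · ext <;> simp [CplxPoly.evalAt, imUnit]

/-- Write `F = (Z - z) ^ n * G` with `G` nonzero at the corner `z`. On `G` both edges see the same
value, each factor `Z - z` contributes one power of `i`, and compatibility is multiplicative. -/
theorem cornerCompatible_toXY (x y : R) {F : (Cplx R)[X]} (hF : F ≠ 0) :
    CornerCompatible x y (toXY F) := by
  rw [← pow_mul_divByMonic_rootMultiplicity_eq F (⟨x, y⟩ : Cplx R)]
  have h := cornerCompatible_of_eval_ne_zero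
    (eval_divByMonic_pow_rootMultiplicity_ne_zero (⟨x, y⟩ : Cplx R) hF)
  generalize F.rootMultiplicity (⟨x, y⟩ : Cplx R) = n at h ⊢
  generalize F /ₘ (X - C (⟨x, y⟩ : Cplx R)) ^ _ = G at h ⊢
  induction n with
  | zero => rwa [pow_zero, one_mul]
  | succ n ih =>
    have e : toXY ((X - C (⟨x, y⟩ : Cplx R)) ^ (n + 1) * G)
        = toXY (X - C (⟨x, y⟩ : Cplx R)) * toXY ((X - C (⟨x, y⟩ : Cplx R)) ^ n * G) := by
      rw [pow_succ', mul_assoc]; simp only [toXY, map_mul]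
    rw [e]
    exact (cornerCompatible_X_sub_C x y).mul ih

variable [IsRealClosed R]

theorem windBig_mul_of_cornerCompatible {x₀ x₁ y₀ y₁ : R} (hx : x₀ < x₁) (hy : y₀ < y₁)
    {F G : MvPolynomial (Fin 2) (Cplx R)} (hF : ∀ x y, CornerCompatible x y F)
    (hG : ∀ x y, CornerCompatible x y G) :
    windBig (F * G) x₀ x₁ y₀ y₁ = windBig F x₀ x₁ y₀ y₁ + windBig G x₀ x₁ y₀ y₁ := by
  choose u m hu hu' using hF
  choose v n hv hv' using hG
  -- The two edges at a corner give the same defect, so over the whole boundary each corner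
  -- contributes twice with opposite signs.
  have hδ : ∀ x y, angleDefect (imUnit R ^ m x y * u x y) (imUnit R ^ n x y * v x y)
      = angleDefect (u x y) (v x y) := fun x y => by
    rw [angleDefect_imUnit_pow_mul, angleDefect_comm, angleDefect_imUnit_pow_mul,
      angleDefect_comm]
  rw [windBig_eq, windBig_eq, windBig_eq, restrHorizontal_mul, restrHorizontal_mul,
    restrVertical_mul, restrVertical_mul,
    edgeIndex_mul hx (hu x₀ y₀) (hv x₀ y₀) (hu x₁ y₀) (hv x₁ y₀),
    edgeIndex_mul hx (hu x₀ y₁) (hv x₀ y₁) (hu x₁ y₁) (hv x₁ y₁),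
    edgeIndex_mul hy (hu' x₀ y₀) (hv' x₀ y₀) (hu' x₀ y₁) (hv' x₀ y₁),
    edgeIndex_mul hy (hu' x₁ y₀) (hv' x₁ y₀) (hu' x₁ y₁) (hv' x₁ y₁)]
  simp only [hδ]
  ring

end Corners

end WindingNumber

/-! ### Additivity for rational functions. -/

theorem proposition3p3 {R : Type*} [Field R] [LinearOrder R] [IsStrictOrderedRing R]
    [IsRealClosed R] (f g : RatFunc (WindingNumber.Cplx R)) (hf : f ≠ 0) (hg : g ≠ 0)
    (x₀ x₁ y₀ y₁ : R) (hx : x₀ < x₁) (hy : y₀ < y₁) :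
    WindingNumber.windRat (f * g) x₀ x₁ y₀ y₁ =
      WindingNumber.windRat f x₀ x₁ y₀ y₁ + WindingNumber.windRat g x₀ x₁ y₀ y₁ := by
  have hcorner : ∀ h : RatFunc (WindingNumber.Cplx R), h ≠ 0 → ∀ x y,
      WindingNumber.CornerCompatible x y
        (WindingNumber.toXY h.num * WindingNumber.conjPoly (WindingNumber.toXY h.denom)) :=
    fun h h0 x y => (WindingNumber.cornerCompatible_toXY x y (RatFunc.num_ne_zero h0)).mul
      (WindingNumber.cornerCompatible_toXY x y h.denom_ne_zero).conjPoly
  -- This fraction need not be reduced, so `windRat_div` is needed to compute with it.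
  have hfg : f * g = algebraMap _ (RatFunc (WindingNumber.Cplx R)) (f.num * g.num)
      / algebraMap _ _ (f.denom * g.denom) := by
    conv_lhs => rw [← RatFunc.num_div_denom f, ← RatFunc.num_div_denom g]
    rw [div_mul_div_comm, map_mul, map_mul]
  have e : WindingNumber.toXY (f.num * g.num)
      * WindingNumber.conjPoly (WindingNumber.toXY (f.denom * g.denom))
      = (WindingNumber.toXY f.num * WindingNumber.conjPoly (WindingNumber.toXY f.denom))
        * (WindingNumber.toXY g.num * WindingNumber.conjPoly (WindingNumber.toXY g.denom)) := by
    have h : ∀ P Q : Polynomial (WindingNumber.Cplx R), WindingNumber.toXY (P * Q)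
        = WindingNumber.toXY P * WindingNumber.toXY Q := fun P Q => map_mul _ P Q
    rw [h, h, WindingNumber.conjPoly_mul, mul_mul_mul_comm]
  rw [hfg, WindingNumber.windRat_div _ _ (mul_ne_zero f.denom_ne_zero g.denom_ne_zero), e,
    WindingNumber.windBig_mul_of_cornerCompatible hx hy (hcorner f hf) (hcorner g hg)]
  rfl
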